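/- Consider elections with three candidates. Each of $V$ voters casts a ballot. In the complete ballot case a ballot is one of the six strict rankings of the candidates; in the partial ballot case it is one of these six rankings or one of the three ballots that rank a single candidate. A profile records the number of voters casting each type of ballot. The winner is determined by instant runoff voting (IRV): a candidate with more than half of the first-place votes wins (a majority candidate); if there is none, the candidate with the fewest first-place votes is eliminated, the ballots ranking that candidate first pass to their second choice (if they have none, they are discarded), and the remaining candidate with more votes wins. The plurality loser is the candidate with the fewest first-place votes, and the runner-up is the candidate that is neither the IRV winner nor the plurality loser. An election demonstrates a plurality loser (PL) reinforcement paradox, respectively a runner-up (RU) reinforcement paradox, if its ballots can be partitioned into two sets such that the plurality loser, respectively the runner-up, of the whole election is the IRV winner in each of the two sets. Under the impartial anonymous culture (IAC, or $\mathrm{Dir}(1)$) model with $V$ voters, the profile is uniformly distributed on the discrete ballot simplex, that is, on the set of all tuples of nonnegative integers with sum $V$ indexed by the six (complete ballots) or nine (partial ballots) types of ballot. As $V\to\infty$, the probabilities that an election demonstrates a PL or RU paradox (at least one), an RU paradox, a PL paradox, and both a PL and an RU paradox converge, and so do the probabilities of these events conditioned on the absence of a majority candidate. The limits are as follows. - Complete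 ballots: PL or RU $\frac{191}{768}$; RU $\frac{127}{576}$; PL $\frac{79}{1152}$; PL and RU $\frac{31}{768}$. - Complete ballots, conditioned on there being no majority candidate: PL or RU $\frac{191}{336}$; RU $\frac{127}{252}$; PL $\frac{79}{504}$; PL and RU $\frac{31}{336}$. - Partial ballots: PL or RU $\frac{1341257}{5308416}$; RU $\frac{527}{2304}$; PL $\frac{7031}{110592}$; PL and RU $\frac{210439}{5308416}$. - Partial ballots, conditioned on there being no majority candidate: PL or RU $\frac{1341257}{3006720}$; RU $\frac{527}{1305}$; PL $\frac{7031}{62640}$; PL and RU $\frac{210439}{3006720}$. -/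

import Mathlib

open Filter Topology

/-- The three candidates. -/
abbrev Candidate : Type := Fin 3

/-- A ballot in a three-candidate election: a first choice, and possibly a different second choice.
A ballot with a second choice ranks the remaining candidate third and so is a complete ranking;
a ballot without a second choice ranks one candidate only. There are nine ballots, six of which
are complete. -/
abbrev Ballot : Type := {b : Candidate × Option Candidate // b.2 ≠ some b.1}

/-- The first choice on a ballot. -/
def firstChoice (b : Ballot) : Candidate := b.1.1

/-- The second choice on a ballot, if there is one. -/
def secondChoice (b : Ballot) : Option Candidate := b.1.2

/-- The six complete rankings. -/
def completeBallots : Finset Ballot := {b | (secondChoice b).isSome}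

/-- All nine ballots: the six complete rankings and the three one-candidate ballots. -/
def partialBallots : Finset Ballot := Finset.univ

/-- A profile records how many voters cast each ballot. -/
abbrev Profile : Type := Ballot → ℕ

/-- The number of voters. -/
def numVoters (P : Profile) : ℕ := ∑ b, P b

/-- The number of first-place votes of `c`. -/
def firstVotes (P : Profile) (c : Candidate) : ℕ := ∑ b with firstChoice b = c, P b

/-- The number of votes of `c` in the second round, after `d` has been eliminated: its own
first-place votes and the ballots of `d` on which `c` is second. Ballots that rank `d` only are
exhausted. -/
def secondRoundVotes (P : Profile) (d c : Candidate) : ℕ :=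
  ∑ b with firstChoice b = c ∨ (firstChoice b = d ∧ secondChoice b = some c), P b

/-- `c` has a majority of the first-place votes. -/
def IsMajorityCandidate (P : Profile) (c : Candidate) : Prop :=
  numVoters P < 2 * firstVotes P c

/-- No candidate has a majority of the first-place votes. -/
def NoMajorityCandidate (P : Profile) : Prop := ∀ c, ¬ IsMajorityCandidate P c

/-- `d` has the fewest first-place votes, possibly tied. -/
def HasFewestFirstVotes (P : Profile) (d : Candidate) : Prop :=
  ∀ e, firstVotes P d ≤ firstVotes P e

/-- `c` is the (unambiguous) winner under instant runoff voting: either `c` has a majority of the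
first-place votes, or nobody has one and, when a candidate `d` with the fewest first-place votes is
eliminated (whichever one, in case of a tie), `c` survives and has strictly more votes than the
other remaining candidate in the second round. -/
def IsIRVWinner (P : Profile) (c : Candidate) : Prop :=
  IsMajorityCandidate P c ∨
    (NoMajorityCandidate P ∧
      ∀ d, HasFewestFirstVotes P d →
        c ≠ d ∧ ∀ e, e ≠ c → e ≠ d → secondRoundVotes P d e < secondRoundVotes P d c)

/-- `c` is the plurality loser: the candidate with the smallest number of first-place votes. -/
def IsPluralityLoser (P : Profile) (c : Candidate) : Prop :=
  ∀ d, d ≠ c → firstVotes P c < firstVotes P d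

/-- `c` is the runner-up: the candidate that is neither the winner nor the plurality loser. -/
def IsRunnerUp (P : Profile) (c : Candidate) : Prop :=
  ∃ w l, IsIRVWinner P w ∧ IsPluralityLoser P l ∧ c ≠ w ∧ c ≠ l

/-- The ballots can be split into two parts such that `c` is the winner in each part. -/
def WinsBothPartsOfSplit (P : Profile) (c : Candidate) : Prop :=
  ∃ P₁ P₂ : Profile, P₁ + P₂ = P ∧ IsIRVWinner P₁ c ∧ IsIRVWinner P₂ c

/-- The election demonstrates a plurality loser reinforcement paradox. -/
def PLParadox (P : Profile) : Prop :=
  ∃ c, IsPluralityLoser P c ∧ WinsBothPartsOfSplit P c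

/-- The election demonstrates a runner-up reinforcement paradox. -/
def RUParadox (P : Profile) : Prop :=
  ∃ c, IsRunnerUp P c ∧ WinsBothPartsOfSplit P c

/-- The election demonstrates a plurality loser or a runner-up reinforcement paradox. -/
def EitherParadox (P : Profile) : Prop := PLParadox P ∨ RUParadox P

/-- The election demonstrates a double reinforcement paradox. -/
def DoubleParadox (P : Profile) : Prop := PLParadox P ∧ RUParadox P

/-- The discrete ballot simplex: all profiles of `V` voters who cast ballots in `S` only. -/
def ballotSimplex (S : Finset Ballot) (V : ℕ) : Finset Profile := S.piAntidiag V

open Classical in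
/-- The probability of the event `E` when the profile is uniformly distributed on the discrete
ballot simplex with `V` voters. -/
noncomputable def iacProb (S : Finset Ballot) (E : Profile → Prop) (V : ℕ) : ℝ :=
  (((ballotSimplex S V).filter E).card : ℝ) / ((ballotSimplex S V).card : ℝ)

/-- The conditional probability of `E` given `F` in the same model. -/
noncomputable def iacCondProb (S : Finset Ballot) (E F : Profile → Prop) (V : ℕ) : ℝ :=
  iacProb S (fun P => E P ∧ F P) V / iacProb S F V

/-! Each event is, up to a bounded distance from its walls, membership of the vector of ballot
counts in a rational polyhedral cone. Lattice points equidistribute, so the limiting probability is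
the share of the positive orthant, cut off at coordinate sum 1, that the cone occupies. What remains
is to find the cones and to compute exact volumes in dimensions six and nine.

The cones. Let A win both parts of a split, with rivals B and C. If the same candidate is eliminated
in both parts, the inequalities add up and A survives that elimination in the whole election, which
is impossible for the plurality loser or the runner-up. So B goes out in one part and C in the
other. Adding the inequalities of the parts gives four linear conditions
(`WinsBothPartsOfSplit.inequalities`). Conversely, these conditions with some slack, together with
slack against a majority for either rival, allow an explicit split (`winsBothPartsOfSplit_of_le`):
every ballot B > C goes to the part where C is eliminated, every ballot C > B to the other, and the
remaining numbers are chosen greedily.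

Limits. A closed convex set has a null frontier, so lattice points in its slice are counted by
volume. Shrinking the cone by δ absorbs the bounded slack (`tendsto_countCompositions_cone`). Slices
scale with height, so ratios of slice volumes are ratios of truncated cone volumes
(`volume_cone_eq`).

Volumes. A simplicial cone is stored as a matrix whose columns list the values of the linear forms
on its generators. If a form takes both signs, the cone is cut along the positive combination of two
generators on which the form vanishes (`volume_coneRegion_split`). Once no form is left, the volume
is that of the standard simplex divided by the product of the weights. The kernel runs this
recursion on packed integers; `coneVolume_sound` shows that any successful run is correct, whatever
pivots were chosen.

Finally, summing over the roles of the candidates multiplies by 3 or 6, inclusion–exclusion gives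
the event "at least one paradox", and since every paradox excludes a majority candidate,
conditioning is division. -/

open MeasureTheory

/-! ### Cone volumes by repeated subdivision, as a program for the kernel -/

/-- Application of `k` to `x` in a form that makes the kernel evaluate `x` to a literal first. -/
noncomputable def natForce {α : Type} (x : ℕ) (k : ℕ → α) : α :=
  Nat.rec (motive := fun _ => α) (k (nat_lit 0)) (fun n _ => k (Nat.succ n)) x

theorem natForce_eq {α : Type} (x : ℕ) (k : ℕ → α) : natForce x k = k x := by
  cases x <;> rfl

/-- A column of an integer matrix. The entries are the digits of `e` in base `2 ^ 64`, shifted by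
`2 ^ 63`; `p` and `n` mark in base `16` the positive and the negative entries. Only `e` carries
meaning: `p` and `n` guide the choice of pivots. -/
structure PackedColumn where
  e : ℕ
  p : ℕ
  n : ℕ

/-- The shifted entry number `d` of a packed column. -/
noncomputable def packedDigit (E d : ℕ) : ℕ :=
  Nat.mod (Nat.div E (Nat.pow (nat_lit 18446744073709551616) d)) (nat_lit 18446744073709551616)

noncomputable def markDigit (E d : ℕ) : ℕ :=
  Nat.mod (Nat.div E (Nat.pow (nat_lit 16) d)) (nat_lit 16)

/-- Digit `d` of the sum in base 16 counts the columns that are positive in row `d`; with at most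
nine columns there is no carry. -/
noncomputable def sumPositiveMarks (cols : List PackedColumn) : ℕ :=
  List.rec (nat_lit 0) (fun c _ ih => Nat.add c.p ih) cols

/-- Calls `k` with a row that has the fewest positive entries, and the number of these. -/
noncomputable def selectRow {α : Type} (SP : ℕ) (k : ℕ → ℕ → α) (live : List ℕ) : ℕ → ℕ → α :=
  List.rec (motive := fun _ => ℕ → ℕ → α) k (fun d _ ih b bp => natForce (markDigit SP d) fun q =>
    Bool.rec (motive := fun _ => α) (ih d q) (ih b bp) (Nat.ble bp q)) live

/-- Calls `k` with the first column that is negative in row `d`. -/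
noncomputable def selectNegative {α : Type} (d : ℕ) (z : α) (k : ℕ → PackedColumn → α)
    (cols : List PackedColumn) : ℕ → α :=
  List.rec (motive := fun _ => ℕ → α) (fun _ => z) (fun c _ ih j =>
    Nat.rec (motive := fun _ => α) (ih (Nat.succ j)) (fun _ _ => k j c) (markDigit c.n d)) cols

/-- Calls `k` with the column positive in row `d` that is negative in as many rows as possible
among those marked in `pj`. -/
noncomputable def selectPositive {α : Type} (d pj : ℕ) (k : ℕ → PackedColumn → α)
    (cols : List PackedColumn) : ℕ → ℕ → ℕ → PackedColumn → α :=
  List.rec (motive := fun _ => ℕ → ℕ → ℕ → PackedColumn → α) (fun _ _ i c => k i c)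
    (fun c _ ih a s i ci =>
      Nat.rec (motive := fun _ => α) (ih (Nat.succ a) s i ci) (fun _ _ =>
        -- Since 16 ≡ 1 mod 15, the residue of a number whose hexadecimal digits are 0 or 1 counts
        -- the ones. The successor makes every candidate beat the initial score 0.
        natForce (Nat.succ (Nat.mod (Nat.land c.n pj) (nat_lit 15))) fun t =>
          Bool.rec (motive := fun _ => α) (ih (Nat.succ a) t a c) (ih (Nat.succ a) s i ci)
            (Nat.ble t s)) (markDigit c.p d)) cols

/-- The signs are read from the digits, where `2 ^ 63` stands for zero, so this test does not trust
the marks. -/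
noncomputable def rowNonpos (d : ℕ) (cols : List PackedColumn) : Bool :=
  List.rec true (fun c _ ih =>
    Bool.rec false ih (Nat.ble (packedDigit c.e d) (nat_lit 9223372036854775808))) cols

noncomputable def rowNonneg (d : ℕ) (cols : List PackedColumn) : Bool :=
  List.rec true (fun c _ ih =>
    Bool.rec false ih (Nat.ble (nat_lit 9223372036854775808) (packedDigit c.e d))) cols

noncomputable def rowHasPos (d : ℕ) (cols : List PackedColumn) : Bool :=
  List.rec false (fun c _ ih =>
    Bool.rec true ih (Nat.ble (packedDigit c.e d) (nat_lit 9223372036854775808))) cols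

/-- The product of the entries of row `1`, the row of weights. -/
noncomputable def weightProd (cols : List PackedColumn) : ℕ :=
  List.rec (nat_lit 1) (fun c _ ih =>
    Nat.mul (Nat.sub (packedDigit c.e (nat_lit 1)) (nat_lit 9223372036854775808)) ih) cols

noncomputable def removeRow (d : ℕ) (l : List ℕ) : List ℕ :=
  List.rec [] (fun a l ih => Bool.rec (a :: ih) l (Nat.beq a d)) l

noncomputable def setColumn {α : Type} (c : PackedColumn) (l : List PackedColumn) :
    ℕ → (List PackedColumn → α) → α :=
  List.rec (motive := fun _ => ℕ → (List PackedColumn → α) → α) (fun _ k => k [])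
    (fun a l ih i k => Nat.rec (motive := fun _ => α) (k (c :: l))
      (fun i _ => ih i fun l => k (a :: l)) i) l

/-- The value `al * (x - 1) + be * (y - 1) + 1` if `x` and `y` are positive, and `0` otherwise. -/
noncomputable def combineValues (al be x y : ℕ) : ℕ :=
  Nat.rec (nat_lit 0) (fun x _ => Nat.rec (nat_lit 0)
    (fun y _ => Nat.succ (Nat.add (Nat.mul al x) (Nat.mul be y))) y) x

/-- The marks of the digits of `X` that are at least `2 ^ 63`. -/
noncomputable def topMarks (m X : ℕ) : ℕ :=
  Nat.land (Nat.div X (nat_lit 9223372036854775808)) m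

/-- The two columns that come from pivoting at `i` and `j` with multipliers `al` and `be`. -/
noncomputable def pivotStep (ones ones' Ho : ℕ)
    (ih : List PackedColumn → ℕ → ℕ) (cols : List PackedColumn)
    (M i j al be : ℕ) (ci cj : PackedColumn) : ℕ :=
  -- `M` bounds the absolute values of all entries. If it reaches `2 ^ 63`, digits could overflow
  -- and the run fails.
  natForce (Nat.mul (Nat.add al be) M) fun M =>
  Bool.rec (motive := fun _ => ℕ)
    -- The combination carries the shift `al + be` times and needs it once. `Ho` is added first so
    -- that the subtraction does not truncate.
    (natForce (Nat.sub (Nat.add (Nat.add (Nat.mul al cj.e) (Nat.mul be ci.e)) Ho)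
      (Nat.mul (Nat.add al be) Ho)) fun E =>
    -- Subtracting 1 from each digit leaves the top bit set exactly for positive entries. Modulo `2
    -- ^ 64 - 16` the base `2 ^ 64` becomes 16, which compresses the marks. `ones'` lacks the lowest
    -- one and so masks out the hash row 0.
    natForce (Nat.mod (topMarks ones' (Nat.sub E ones)) (nat_lit 18446744073709551600)) fun p =>
    natForce (Nat.mod (Nat.sub ones' (topMarks ones' E)) (nat_lit 18446744073709551600)) fun n =>
    combineValues al be (setColumn ⟨E, p, n⟩ cols j fun cols => ih cols M)
      (setColumn ⟨E, p, n⟩ cols i fun cols => ih cols M))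
    (nat_lit 0) (Nat.ble (nat_lit 9223372036854775808) M)

/-- One step of `coneVolume`. -/
noncomputable def coneVolumeStep (D ones ones' Ho : ℕ)
    (ih : List ℕ → List PackedColumn → ℕ → ℕ)
    (live : List ℕ) (cols : List PackedColumn) (M : ℕ) : ℕ :=
  List.rec (motive := fun _ => ℕ)
    -- No row is left: the simplicial cone has volume 1 over the product of weights, and the run
    -- fails unless `D` is divisible by that product.
    (natForce (weightProd cols) fun q =>
      Nat.rec (motive := fun _ => ℕ) (Nat.succ (Nat.div D q)) (fun _ _ => nat_lit 0) (Nat.mod D q))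
    (fun a _ _ =>
      natForce (sumPositiveMarks cols) fun SP =>
      selectRow SP (fun d p =>
        Nat.rec (motive := fun _ => ℕ)
          (Bool.rec (motive := fun _ => ℕ) (nat_lit 0) (nat_lit 1) (rowNonpos d cols))
          (fun _ _ => selectNegative d
            (Bool.rec (motive := fun _ => ℕ) (nat_lit 0)
              (Bool.rec (motive := fun _ => ℕ) (nat_lit 0) (ih (removeRow d live) cols M)
                (rowHasPos d cols)) (rowNonneg d cols))
            (fun j cj => selectPositive d cj.p (fun i ci =>
              natForce (Nat.sub (packedDigit ci.e d) (nat_lit 9223372036854775808)) fun a =>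
              natForce (Nat.sub (nat_lit 9223372036854775808) (packedDigit cj.e d)) fun b =>
              natForce (Nat.gcd a b) fun g =>
              natForce (Nat.div a g) fun al =>
              natForce (Nat.div b g) fun be =>
              -- A zero product means that a sign promised by the marks is not there; the run then
              -- fails instead of returning a wrong value.
              Nat.rec (motive := fun _ => ℕ) (nat_lit 0)
                (fun _ _ => pivotStep ones ones' Ho (ih live) cols M i j al be ci cj)
                (Nat.mul al be))
              cols (nat_lit 0) (nat_lit 0) j cj)
            cols (nat_lit 0)) p)
        -- The initial count 1000 exceeds every digit in base 16, so the first row examined replaces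
        -- it.
        live a (nat_lit 1000))
    live

/-- `D` times the volume of a simplicial decomposition of the cone cut out by the rows `live`,
plus one, or `0` if the computation fails. -/
noncomputable def coneVolume (D ones ones' Ho f : ℕ) : List ℕ → List PackedColumn → ℕ → ℕ :=
  Nat.rec (motive := fun _ => List ℕ → List PackedColumn → ℕ → ℕ) (fun _ _ _ => nat_lit 0)
    (fun _ ih => coneVolumeStep D ones ones' Ho ih) f

/-- Prepends to a column the weight `1` and a combination of the entries. The latter plays no
role in the computation; it makes the low digits of the packed columns differ, so that
they are hashed well. -/
def augment (l : List ℤ) : List ℤ := l.foldr (fun x a => x + 3 * a) 0 :: 1 :: l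

/-- The digits of a column, packed. -/
def packDigits (l : List ℤ) : ℕ :=
  l.foldr (fun x a => (x + 9223372036854775808).toNat + 18446744073709551616 * a) 0

def packMarks (f : ℤ → Bool) (l : List ℤ) : ℕ := l.foldr (fun x a => (f x).toNat + 16 * a) 0

noncomputable def packColumns {α : Type} (ls : List (List ℤ)) : (List PackedColumn → α) → α :=
  List.rec (motive := fun _ => (List PackedColumn → α) → α) (fun k => k [])
    (fun l _ ih k => natForce (packDigits (augment l)) fun e =>
      natForce (16 * packMarks (fun x => 0 < x) (augment l).tail) fun p =>
      natForce (16 * packMarks (fun x => x < 0) (augment l).tail) fun n =>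
      ih fun cs => k (⟨e, p, n⟩ :: cs)) ls

/-- `coneVolume` for the matrix with columns `ls`, each of length `R`. -/
noncomputable def matrixConeVolume (D R : ℕ) (ls : List (List ℤ)) : ℕ :=
  natForce (packDigits (List.replicate (R + 2) (-9223372036854775807))) fun ones =>
  natForce (Nat.mul (nat_lit 9223372036854775808) ones) fun Ho =>
  natForce (Nat.pred ones) fun ones' =>
  packColumns ls fun cols =>
    -- Rows 0 and 1 hold the hash and the weights, so the inequalities start at row 2. The number
    -- 100 bounds the depth of the recursion.
    coneVolume D ones ones' Ho (nat_lit 100) ((List.range R).map fun k => k + 2) cols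
      (nat_lit 1048576)

/-! ### What the selection routines and the packed arithmetic guarantee -/

section Specifications

theorem packedDigit_def (E d : ℕ) :
    packedDigit E d = E / 18446744073709551616 ^ d % 18446744073709551616 := rfl

/-- Correctness needs only that some available row is chosen; minimality affects the running time
alone. The same holds for the choice of columns below. -/
theorem selectRow_spec {α : Type} (SP : ℕ) (k : ℕ → ℕ → α) (live : List ℕ) (b bp : ℕ) :
    ∃ d p, (d ∈ live ∨ d = b) ∧ selectRow SP k live b bp = k d p := by
  induction live generalizing b bp with
  | nil => exact ⟨b, bp, Or.inr rfl, rfl⟩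
  | cons a l ih =>
    have h : selectRow SP k (a :: l) b bp = Bool.rec (motive := fun _ => α)
        (selectRow SP k l a (markDigit SP a)) (selectRow SP k l b bp)
        (Nat.ble bp (markDigit SP a)) :=
      natForce_eq (markDigit SP a) fun q => Bool.rec (motive := fun _ => α)
        (selectRow SP k l a q) (selectRow SP k l b bp) (Nat.ble bp q)
    rw [h]
    cases Nat.ble bp (markDigit SP a) with
    | false =>
      obtain ⟨d, p, hd, h⟩ := ih a (markDigit SP a)
      refine ⟨d, p, Or.inl ?_, h⟩
      rcases hd with hd | rfl <;> simp [*]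
    | true =>
      obtain ⟨d, p, hd, h⟩ := ih b bp
      refine ⟨d, p, ?_, h⟩
      rcases hd with hd | rfl <;> simp [*]

theorem selectNegative_spec {α : Type} (d : ℕ) (z : α) (k : ℕ → PackedColumn → α)
    (cols : List PackedColumn) (s : ℕ) :
    selectNegative d z k cols s = z ∨
      ∃ j c, cols[j]? = some c ∧ selectNegative d z k cols s = k (s + j) c := by
  induction cols generalizing s with
  | nil => exact Or.inl rfl
  | cons a l ih =>
    have h : selectNegative d z k (a :: l) s = Nat.rec (motive := fun _ => α)
        (selectNegative d z k l (Nat.succ s)) (fun _ _ => k s a) (markDigit a.n d) := rfl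
    rw [h]
    cases markDigit a.n d with
    | zero =>
      rcases ih (Nat.succ s) with h | ⟨j, c, hj, h⟩
      · exact Or.inl h
      · exact Or.inr ⟨j + 1, c, by simpa using hj, h.trans (by congr 1; omega)⟩
    | succ m => exact Or.inr ⟨0, a, rfl, rfl⟩

theorem selectPositive_spec {α : Type} (d pj : ℕ) (k : ℕ → PackedColumn → α)
    (cols : List PackedColumn) (s t i : ℕ) (ci : PackedColumn) :
    selectPositive d pj k cols s t i ci = k i ci ∨
      ∃ j c, cols[j]? = some c ∧ selectPositive d pj k cols s t i ci = k (s + j) c := by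
  induction cols generalizing s t i ci with
  | nil => exact Or.inl rfl
  | cons a l ih =>
    have key : ∀ t i ci, (selectPositive d pj k l (Nat.succ s) t i ci = k i ci ∨
        ∃ j c, (a :: l)[j]? = some c ∧
          selectPositive d pj k l (Nat.succ s) t i ci = k (s + j) c) := by
      intro t i ci
      rcases ih (Nat.succ s) t i ci with h | ⟨j, c, hj, h⟩
      · exact Or.inl h
      · exact Or.inr ⟨j + 1, c, by simpa using hj, h.trans (by congr 1; omega)⟩
    have h : selectPositive d pj k (a :: l) s t i ci = Nat.rec (motive := fun _ => α)
        (selectPositive d pj k l (Nat.succ s) t i ci) (fun _ _ =>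
          natForce (Nat.succ (Nat.mod (Nat.land a.n pj) 15)) fun u =>
          Bool.rec (motive := fun _ => α) (selectPositive d pj k l (Nat.succ s) u s a)
            (selectPositive d pj k l (Nat.succ s) t i ci) (Nat.ble u t)) (markDigit a.p d) := rfl
    rw [h]
    cases markDigit a.p d with
    | zero => exact key t i ci
    | succ m =>
      simp only [natForce_eq]
      cases Nat.ble (Nat.succ (Nat.mod (Nat.land a.n pj) 15)) t with
      | true => exact key t i ci
      | false =>
        rcases key (Nat.succ (Nat.mod (Nat.land a.n pj) 15)) s a with h | h
        · exact Or.inr ⟨0, a, rfl, h⟩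
        · exact Or.inr h

theorem rowNonpos_spec (d : ℕ) (cols : List PackedColumn) (h : rowNonpos d cols = true) :
    ∀ c ∈ cols, packedDigit c.e d ≤ 9223372036854775808 := by
  induction cols with
  | nil => simp
  | cons a l ih =>
    have e : rowNonpos d (a :: l) = Bool.rec false (rowNonpos d l)
      (Nat.ble (packedDigit a.e d) 9223372036854775808) := rfl
    rw [e] at h
    cases hb : Nat.ble (packedDigit a.e d) 9223372036854775808 with
    | false => rw [hb] at h; exact absurd h (by simp)
    | true =>
      rw [hb] at h
      simpa using ⟨Nat.le_of_ble_eq_true hb, ih h⟩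

theorem rowNonneg_spec (d : ℕ) (cols : List PackedColumn) (h : rowNonneg d cols = true) :
    ∀ c ∈ cols, 9223372036854775808 ≤ packedDigit c.e d := by
  induction cols with
  | nil => simp
  | cons a l ih =>
    have e : rowNonneg d (a :: l) = Bool.rec false (rowNonneg d l)
      (Nat.ble 9223372036854775808 (packedDigit a.e d)) := rfl
    rw [e] at h
    cases hb : Nat.ble 9223372036854775808 (packedDigit a.e d) with
    | false => rw [hb] at h; exact absurd h (by simp)
    | true =>
      rw [hb] at h
      simpa using ⟨Nat.le_of_ble_eq_true hb, ih h⟩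

theorem rowHasPos_spec (d : ℕ) (cols : List PackedColumn) (h : rowHasPos d cols = true) :
    ∃ c ∈ cols, 9223372036854775808 < packedDigit c.e d := by
  induction cols with
  | nil => exact absurd h (by simp [rowHasPos])
  | cons a l ih =>
    have e : rowHasPos d (a :: l) = Bool.rec true (rowHasPos d l)
      (Nat.ble (packedDigit a.e d) 9223372036854775808) := rfl
    rw [e] at h
    cases hb : Nat.ble (packedDigit a.e d) 9223372036854775808 with
    | false =>
      refine ⟨a, by simp, ?_⟩
      by_contra hc
      rw [Nat.ble_eq_true_of_le (not_lt.1 hc)] at hb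
      simp at hb
    | true =>
      rw [hb] at h
      obtain ⟨c, hc, h⟩ := ih h
      exact ⟨c, by simp [hc], h⟩

theorem mem_removeRow (d : ℕ) (l : List ℕ) (k : ℕ) :
    (k ∈ removeRow d l → k ∈ l) ∧ (k ∈ l → k = d ∨ k ∈ removeRow d l) := by
  induction l with
  | nil => simp [removeRow]
  | cons a l ih =>
    have e : removeRow d (a :: l) = Bool.rec (a :: removeRow d l) l (Nat.beq a d) := rfl
    rw [e]
    cases hb : Nat.beq a d with
    | false =>
      simp only [List.mem_cons]
      tauto
    | true =>
      have := Nat.eq_of_beq_eq_true hb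
      subst this
      simp only [List.mem_cons]
      tauto

theorem setColumn_eq {α : Type} (c : PackedColumn) (l : List PackedColumn) (i : ℕ)
    (k : List PackedColumn → α) : setColumn c l i k = k (l.set i c) := by
  induction l generalizing i k with
  | nil => rfl
  | cons a l ih =>
    cases i with
    | zero => rfl
    | succ i => exact ih i _

theorem combineValues_eq_succ {al be x y r : ℕ} (h : combineValues al be x y = r + 1) :
    ∃ a b, x = a + 1 ∧ y = b + 1 ∧ r = al * a + be * b := by
  cases x with
  | zero => exact absurd h (by simp [combineValues])
  | succ a =>
    cases y with
    | zero => exact absurd h (by simp [combineValues])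
    | succ b => exact ⟨a, b, rfl, rfl, (Nat.succ.inj h).symm⟩

theorem weightProd_cons (c : PackedColumn) (l : List PackedColumn) :
    weightProd (c :: l) = (packedDigit c.e 1 - 9223372036854775808) * weightProd l := rfl

/-- The packed columns `cols` hold the first `K` rows of the matrix `e`, whose entries are bounded
by `M`. -/
def Encodes (K M : ℕ) (e : ℕ → ℕ → ℤ) (cols : List PackedColumn) : Prop :=
  ∀ i c, cols[i]? = some c →
    (c.e : ℤ) = ∑ k ∈ Finset.range K, (e i k + 9223372036854775808) * 18446744073709551616 ^ k ∧
    ∀ k < K, |e i k| ≤ M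

theorem sum_mul_pow_div_mod {b : ℕ} (f : ℕ → ℕ) (hf : ∀ k, f k < b) {d K : ℕ} (h : d < K) :
    (∑ k ∈ Finset.range K, f k * b ^ k) / b ^ d % b = f d := by
  induction d generalizing f K with
  | zero =>
    obtain ⟨K, rfl⟩ := Nat.exists_eq_succ_of_ne_zero (by omega : K ≠ 0)
    have : ∑ k ∈ Finset.range (K + 1), f k * b ^ k =
        f 0 + b * ∑ k ∈ Finset.range K, f (k + 1) * b ^ k := by
      rw [Finset.sum_range_succ', Finset.mul_sum, add_comm]
      simp only [pow_zero, mul_one, add_right_inj]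
      exact Finset.sum_congr rfl fun k _ => by ring
    rw [Nat.succ_eq_add_one, this, pow_zero, Nat.div_one, Nat.add_mul_mod_self_left,
      Nat.mod_eq_of_lt (hf 0)]
  | succ d ih =>
    obtain ⟨K, rfl⟩ := Nat.exists_eq_succ_of_ne_zero (by omega : K ≠ 0)
    have hb : 0 < b := (Nat.zero_le _).trans_lt (hf 0)
    have : ∑ k ∈ Finset.range (K + 1), f k * b ^ k =
        f 0 + b * ∑ k ∈ Finset.range K, f (k + 1) * b ^ k := by
      rw [Finset.sum_range_succ', Finset.mul_sum, add_comm]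
      simp only [pow_zero, mul_one, add_right_inj]
      exact Finset.sum_congr rfl fun k _ => by ring
    rw [Nat.succ_eq_add_one, this, pow_succ', ← Nat.div_div_eq_div_mul,
      Nat.add_mul_div_left _ _ hb, Nat.div_eq_of_lt (hf 0), zero_add]
    exact ih (fun k => f (k + 1)) (fun k => hf _) (by omega)

/-- Entries of absolute value below `2 ^ 63` become digits in base `2 ^ 64` after the shift, and
digits are unique. -/
theorem Encodes.packedDigit_eq {K M : ℕ} {e : ℕ → ℕ → ℤ} {cols : List PackedColumn}
    (h : Encodes K M e cols) (hM : M < 9223372036854775808) {i : ℕ} {c : PackedColumn}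
    (hc : cols[i]? = some c) {d : ℕ} (hd : d < K) :
    (packedDigit c.e d : ℤ) = e i d + 9223372036854775808 := by
  obtain ⟨h1, h2⟩ := h i c hc
  set f : ℕ → ℕ := fun k => if k < K then (e i k + 9223372036854775808).toNat else 0 with hf
  have hfk : ∀ k, k < K → (f k : ℤ) = e i k + 9223372036854775808 := by
    intro k hk
    have := abs_le.1 (h2 k hk)
    simp only [hf, hk, if_true]
    omega
  have hlt : ∀ k, f k < 18446744073709551616 := by
    intro k
    by_cases hk : k < K
    · have := abs_le.1 (h2 k hk)
      have := hfk k hk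
      omega
    · simp [hf, hk]
  have he : c.e = ∑ k ∈ Finset.range K, f k * 18446744073709551616 ^ k := by
    have : (c.e : ℤ) = ((∑ k ∈ Finset.range K, f k * 18446744073709551616 ^ k : ℕ) : ℤ) := by
      rw [h1]
      push_cast
      exact Finset.sum_congr rfl fun k hk => by rw [hfk k (Finset.mem_range.1 hk)]
    exact_mod_cast this
  rw [packedDigit_def, he, sum_mul_pow_div_mod f hlt hd, hfk d hd]

theorem Encodes.mono {K M M' : ℕ} {e : ℕ → ℕ → ℤ} {cols : List PackedColumn}
    (h : Encodes K M e cols) (hM : M ≤ M') : Encodes K M' e cols := fun i c hc =>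
  ⟨(h i c hc).1, fun k hk => ((h i c hc).2 k hk).trans (by exact_mod_cast hM)⟩

/-- The matrix `e` after the substitution of `x i + be * x j` for `x i` and `al * x j`
for `x j`. -/
def shearMatrix (i j al be : ℕ) (e : ℕ → ℕ → ℤ) : ℕ → ℕ → ℤ :=
  Function.update e j fun k => al * e j k + be * e i k

theorem Encodes.set {K M al be E : ℕ} {e : ℕ → ℕ → ℤ} {cols : List PackedColumn}
    (h : Encodes K M e cols) (hal : 0 < al) {i j : ℕ} {ci cj c : PackedColumn}
    (hi : cols[i]? = some ci) (hj : cols[j]? = some cj) (hM : (al + be) * M < 9223372036854775808)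
    (hE : E = al * cj.e + be * ci.e + 9223372036854775808 *
        (∑ k ∈ Finset.range K, 18446744073709551616 ^ k) -
      (al + be) * (9223372036854775808 * (∑ k ∈ Finset.range K, 18446744073709551616 ^ k)))
    (hc : c.e = E) :
    Encodes K ((al + be) * M) (shearMatrix i j al be e) (cols.set j c) := by
  obtain ⟨hi1, hi2⟩ := h i ci hi
  obtain ⟨hj1, hj2⟩ := h j cj hj
  have hbd : ∀ k < K, |(al : ℤ) * e j k + be * e i k| ≤ ((al + be) * M : ℕ) := by
    intro k hk
    push_cast
    calc |(al : ℤ) * e j k + be * e i k| ≤ |(al : ℤ) * e j k| + |(be : ℤ) * e i k| := abs_add_le _ _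
      _ = al * |e j k| + be * |e i k| := by
        rw [abs_mul, abs_mul, Nat.abs_cast, Nat.abs_cast]
      _ ≤ al * M + be * M := by
        gcongr
        · exact hj2 k hk
        · exact hi2 k hk
      _ = (al + be) * M := by ring
  have hsum : ∑ k ∈ Finset.range K,
      (((al : ℤ) * e j k + be * e i k) + 9223372036854775808) * 18446744073709551616 ^ k =
      ((al * cj.e + be * ci.e + 9223372036854775808 *
        (∑ k ∈ Finset.range K, 18446744073709551616 ^ k) : ℕ) : ℤ) -
      ((al + be) * (9223372036854775808 *
        (∑ k ∈ Finset.range K, 18446744073709551616 ^ k)) : ℕ) := by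
    push_cast
    rw [hi1, hj1]
    simp only [Finset.mul_sum, ← Finset.sum_add_distrib, ← Finset.sum_sub_distrib]
    exact Finset.sum_congr rfl fun k _ => by ring
  -- The true value of the packed column is nonnegative, so the natural subtraction defining `E`
  -- does not truncate.
  have hnn : (0 : ℤ) ≤ ∑ k ∈ Finset.range K,
      (((al : ℤ) * e j k + be * e i k) + 9223372036854775808) * 18446744073709551616 ^ k := by
    refine Finset.sum_nonneg fun k hk => mul_nonneg ?_ (by positivity)
    have := abs_le.1 (hbd k (Finset.mem_range.1 hk))
    omega
  have hEZ : (E : ℤ) = ∑ k ∈ Finset.range K,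
      (((al : ℤ) * e j k + be * e i k) + 9223372036854775808) * 18446744073709551616 ^ k := by
    rw [hE, Nat.cast_sub (by rw [hsum] at hnn; omega), hsum]
  intro l d hd
  rw [List.getElem?_set] at hd
  by_cases hl : j = l
  · subst hl
    have : j < cols.length := by
      by_contra hh
      rw [List.getElem?_eq_none (not_lt.1 hh)] at hj
      simp at hj
    simp only [this, if_true, Option.some.injEq] at hd
    subst hd
    simp only [shearMatrix, Function.update_self]
    exact ⟨by rw [hc, hEZ], hbd⟩
  · rw [if_neg hl] at hd
    simp only [shearMatrix, Function.update_of_ne (Ne.symm hl)]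
    obtain ⟨h1, h2⟩ := h l d hd
    refine ⟨h1, fun k hk => (h2 k hk).trans ?_⟩
    -- Untouched columns keep their bound, which is at most the new one because `al + be` is
    -- positive.
    exact_mod_cast Nat.le_mul_of_pos_left M (by omega)

end Specifications

/-! ### Volumes of cones under linear substitutions -/

section Cones

/-- A hyperplane through the origin has measure zero. -/
theorem volume_hyperplane {n : ℕ} (a : Fin n → ℝ) (ha : a ≠ 0) :
    volume {x : Fin n → ℝ | ∑ i, a i * x i = 0} = 0 := by
  obtain ⟨i, hi⟩ := Function.ne_iff.1 ha
  let f : (Fin n → ℝ) →ₗ[ℝ] ℝ :=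
    { toFun := fun x => ∑ i, a i * x i
      map_add' := fun x y => by simp [mul_add, Finset.sum_add_distrib]
      map_smul' := fun c x => by
        simp only [Pi.smul_apply, smul_eq_mul, RingHom.id_apply, Finset.mul_sum]
        exact Finset.sum_congr rfl fun _ _ => by ring }
  have h : LinearMap.ker f ≠ ⊤ := by
    intro h
    have : Pi.single i 1 ∈ LinearMap.ker f := by rw [h]; trivial
    rw [LinearMap.mem_ker] at this
    have h2 : f (Pi.single i 1) = a i := by simp [f, Pi.single_apply]
    rw [h2] at this
    exact hi this
  exact Measure.addHaar_submodule volume _ h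

/-- The part below the hyperplane with coefficients `e i 1` of the open cone cut out of the
positive orthant by the rows `live` of `e`. -/
def coneRegion (n : ℕ) (e : ℕ → ℕ → ℤ) (live : List ℕ) : Set (Fin n → ℝ) :=
  {x | (∀ i, 0 < x i) ∧ (∀ k ∈ live, 0 < ∑ i : Fin n, (e i k : ℝ) * x i) ∧
    ∑ i : Fin n, (e i 1 : ℝ) * x i < 1}

/-- The open standard simplex with a vertex at the origin. -/
def openSimplex (n : ℕ) : Set (Fin n → ℝ) := {x | (∀ i, 0 < x i) ∧ ∑ i, x i < 1}

/-- Scaling coordinate `i` by its weight maps this region onto the standard simplex, with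
determinant the product of the weights. -/
theorem volume_coneRegion_nil {n : ℕ} (e : ℕ → ℕ → ℤ) (w : Fin n → ℕ)
    (hw : ∀ i : Fin n, e i 1 = w i) (hpos : ∀ i, 0 < w i) :
    ((∏ i, w i : ℕ) : ENNReal) * volume (coneRegion n e []) = volume (openSimplex n) := by
  let f := Matrix.toLin' (Matrix.diagonal fun i => (w i : ℝ))
  have hdet : LinearMap.det f = ((∏ i, w i : ℕ) : ℝ) := by
    simp [f, LinearMap.det_toLin', Matrix.det_diagonal]
  have hP : 0 < ∏ i, w i := Finset.prod_pos fun i _ => hpos i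
  have hdet0 : LinearMap.det f ≠ 0 := by
    rw [hdet]; exact_mod_cast hP.ne'
  have hset : coneRegion n e [] = f ⁻¹' openSimplex n := by
    ext x
    have hfx : ∀ i, f x i = w i * x i := fun i => by
      simp [f, Matrix.toLin'_apply, Matrix.mulVec_diagonal]
    have hw' : ∀ i : Fin n, (e i 1 : ℝ) = w i := fun i => by rw [hw i]; simp
    simp only [coneRegion, openSimplex, Set.mem_ofPred_eq, Set.mem_preimage, hfx, hw']
    have : ∀ i, (0 < (w i : ℝ) * x i ↔ 0 < x i) := fun i =>
      mul_pos_iff_of_pos_left (by exact_mod_cast hpos i)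
    simp [this]
  rw [hset, Measure.addHaar_preimage_linearMap _ hdet0, hdet, ← mul_assoc,
      abs_of_pos (by positivity),
    ENNReal.ofReal_inv_of_pos (by exact_mod_cast hP), ENNReal.ofReal_natCast,
    ENNReal.mul_inv_cancel (by exact_mod_cast hP.ne') (ENNReal.natCast_ne_top _), one_mul]

/-- The substitution that maps the cone of `shearMatrix i j al be e` to the part of the cone of `e`
where `be * x j < al * x i`. -/
theorem volume_coneRegion_shear {n : ℕ} (e : ℕ → ℕ → ℤ) (live : List ℕ) (i j : Fin n)
    (hij : i ≠ j) (al be : ℕ) (hal : 0 < al) :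
    (al : ENNReal) * volume (coneRegion n (shearMatrix i j al be e) live) =
      volume (coneRegion n e live ∩ {x | (be : ℝ) * x j < al * x i}) := by
  have hal' : (0 : ℝ) < al := by exact_mod_cast hal
  -- This is x_i = y_i + be · y_j, x_j = al · y_j, factored so that its determinant is visibly `al`.
  let f := Matrix.toLin' (Matrix.transvection i j ((be : ℝ) / al) *
    Matrix.diagonal (Function.update (fun _ => (1 : ℝ)) j (al : ℝ)))
  have hdet : LinearMap.det f = al := by
    simp only [f, LinearMap.det_toLin', Matrix.det_mul, Matrix.det_transvection_of_ne _ _ hij,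
      Matrix.det_diagonal, one_mul]
    rw [Finset.prod_update_of_mem (Finset.mem_univ j)]
    simp
  have hf : ∀ y l, f y l = y l + (if l = i then be * y j else 0) +
      (if l = j then ((al : ℝ) - 1) * y j else 0) := by
    intro y l
    simp only [f, Matrix.toLin'_apply, ← Matrix.mulVec_mulVec, Matrix.transvection,
      Matrix.add_mulVec, Matrix.one_mulVec, Pi.add_apply, Matrix.mulVec_diagonal]
    have : (Matrix.single i j ((be : ℝ) / al)).mulVec
        ((Matrix.diagonal (Function.update (fun _ => (1 : ℝ)) j (al : ℝ))).mulVec y) l =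
        if l = i then be * y j else 0 := by
      rw [Matrix.single_mulVec]
      by_cases h : l = i
      · subst h
        simp only [Function.update_self, Matrix.mulVec_diagonal, if_true]
        field_simp
      · simp [h]
    rw [this]
    by_cases hl : l = j
    · subst hl
      simp [Ne.symm hij]
      ring
    · simp [hl]
  have hform : ∀ k y, ∑ l : Fin n, (e l k : ℝ) * f y l =
      ∑ l : Fin n, (shearMatrix i j al be e l k : ℝ) * y l := by
    intro k y
    have h1 : ∀ l : Fin n, (shearMatrix i j al be e l k : ℝ) = e l k +
        (if l = j then ((al : ℝ) - 1) * e j k + be * e i k else 0) := by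
      intro l
      by_cases hl : l = j
      · subst hl
        simp only [shearMatrix, Function.update_self, if_true]
        push_cast
        ring
      · have : (l : ℕ) ≠ j := fun h => hl (Fin.ext h)
        simp [shearMatrix, Function.update_of_ne this, hl]
    simp only [hf, h1, mul_add, add_mul, Finset.sum_add_distrib, mul_ite, ite_mul, mul_zero,
      zero_mul, Finset.sum_ite_eq', Finset.mem_univ, if_true]
    ring
  have hset : coneRegion n (shearMatrix i j al be e) live =
      f ⁻¹' (coneRegion n e live ∩ {x | (be : ℝ) * x j < al * x i}) := by
    ext y
    simp only [coneRegion, Set.mem_preimage, Set.mem_inter_iff, Set.mem_ofPred_eq, hform]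
    have hfi : f y i = y i + be * y j := by simp [hf, hij]
    have hfj : f y j = al * y j := by simp [hf, Ne.symm hij]; ring
    have hpos : (∀ l, 0 < y l) ↔ (∀ l, 0 < f y l) ∧ (be : ℝ) * f y j < al * f y i := by
      rw [hfi, hfj]
      constructor
      · intro h
        refine ⟨fun l => ?_, by nlinarith [h i, h j, mul_pos hal' (h i)]⟩
        by_cases hli : l = i
        · subst hli; rw [hfi]; nlinarith [h l, h j, (Nat.cast_nonneg be : (0:ℝ) ≤ be)]
        by_cases hlj : l = j
        · subst hlj; rw [hfj]; exact mul_pos hal' (h l)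
        · simpa [hf, hli, hlj] using h l
      · rintro ⟨h, h'⟩ l
        by_cases hli : l = i
        · subst hli; nlinarith
        by_cases hlj : l = j
        · subst hlj; have := h l; rw [hfj] at this; exact pos_of_mul_pos_right this hal'.le
        · simpa [hf, hli, hlj] using h l
    rw [hpos]
    tauto
  rw [hset, Measure.addHaar_preimage_linearMap _ (by rw [hdet]; exact hal'.ne'), hdet, ← mul_assoc,
    abs_of_pos (by positivity), ENNReal.ofReal_inv_of_pos hal', ENNReal.ofReal_natCast,
    ENNReal.mul_inv_cancel (by exact_mod_cast hal.ne') (ENNReal.natCast_ne_top _), one_mul]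

/-- The hyperplane al · x_i = be · x_j passes through all other generators and the new one. It is
null and cuts the cone into two simplicial pieces, whose Jacobians are `al` and `be`. -/
theorem volume_coneRegion_split {n : ℕ} (e : ℕ → ℕ → ℤ) (live : List ℕ) (i j : Fin n)
    (hij : i ≠ j) (al be : ℕ) (hal : 0 < al) (hbe : 0 < be) :
    volume (coneRegion n e live) =
      al * volume (coneRegion n (shearMatrix i j al be e) live) +
        be * volume (coneRegion n (shearMatrix j i be al e) live) := by
  rw [volume_coneRegion_shear e live i j hij al be hal,
    volume_coneRegion_shear e live j i hij.symm be al hbe]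
  set S := coneRegion n e live
  have hnull : volume {x : Fin n → ℝ | (al : ℝ) * x i - be * x j = 0} = 0 := by
    have h := volume_hyperplane (Pi.single i (al : ℝ) - Pi.single j (be : ℝ)) (by
      intro h
      have := congrFun h i
      simp [hij] at this
      omega)
    convert h using 3
    funext x
    simp [sub_mul, Finset.sum_sub_distrib, Pi.single_apply]
  have hm : MeasurableSet {x : Fin n → ℝ | (be : ℝ) * x j < al * x i} :=
    measurableSet_lt (by fun_prop) (by fun_prop)
  rw [← measure_inter_add_sdiff S hm]
  congr 1
  apply measure_congr
  have hae : ∀ᵐ x : Fin n → ℝ, (al : ℝ) * x i - be * x j ≠ 0 := by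
    rw [ae_iff]
    simpa using hnull
  filter_upwards [hae] with x hx
  apply propext
  change (x ∈ S ∧ ¬ ((be : ℝ) * x j < al * x i)) ↔ (x ∈ S ∧ (al : ℝ) * x i < be * x j)
  refine and_congr_right fun _ => ?_
  rw [not_lt]
  exact ⟨fun h => lt_of_le_of_ne h fun h' => hx (by rw [h', sub_self]), le_of_lt⟩

theorem coneRegion_eq_empty {n : ℕ} (e : ℕ → ℕ → ℤ) (live : List ℕ) {k : ℕ} (hk : k ∈ live)
    (h : ∀ i : Fin n, e i k ≤ 0) : coneRegion n e live = ∅ := by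
  rw [Set.eq_empty_iff_forall_notMem]
  rintro x ⟨hx, hl, -⟩
  refine absurd (hl k hk) (not_lt.2 (Finset.sum_nonpos fun i _ => ?_))
  exact mul_nonpos_of_nonpos_of_nonneg (by exact_mod_cast h i) (hx i).le

/-- A form with nonnegative coefficients, not all zero, is positive on the whole open orthant, so
its row is redundant. -/
theorem coneRegion_congr {n : ℕ} (e : ℕ → ℕ → ℤ) (live live' : List ℕ) (k : ℕ)
    (h : ∀ i : Fin n, 0 ≤ e i k) (h' : ∃ i : Fin n, 0 < e i k)
    (hl : ∀ l ∈ live', l ∈ live) (hl' : ∀ l ∈ live, l = k ∨ l ∈ live') :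
    coneRegion n e live = coneRegion n e live' := by
  ext x
  simp only [coneRegion, Set.mem_ofPred_eq]
  refine and_congr_right fun hx => and_congr_left fun _ => ⟨fun H l hm =>
      H l (hl l hm), fun H l hm => ?_⟩
  rcases hl' l hm with rfl | hm
  · obtain ⟨i, hi⟩ := h'
    refine Finset.sum_pos' (fun i _ => mul_nonneg (by exact_mod_cast h i) (hx i).le)
      ⟨i, Finset.mem_univ i, mul_pos (by exact_mod_cast hi) (hx i)⟩
  · exact H l hm

end Cones

/-! ### Soundness of the volume recursion -/

section Soundness

theorem coneVolume_succ (D ones ones' Ho f : ℕ) (live : List ℕ) (cols : List PackedColumn) (M : ℕ) :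
    coneVolume D ones ones' Ho (f + 1) live cols M =
      coneVolumeStep D ones ones' Ho (coneVolume D ones ones' Ho f) live cols M := rfl

theorem weightProd_spec {n K M : ℕ} {e : ℕ → ℕ → ℤ} {cols : List PackedColumn}
    (hlen : cols.length = n) (henc : Encodes K M e cols) (hM : M < 9223372036854775808)
    (hK : 1 < K) :
    weightProd cols = ∏ i : Fin n, (e i 1).toNat := by
  subst hlen
  induction cols generalizing e with
  | nil => rfl
  | cons a l ih =>
    have hl : Encodes K M (fun i => e (i + 1)) l := fun i c hc => henc (i + 1) c (by simpa using hc)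
    rw [weightProd_cons, ih hl]
    have : (∏ i : Fin (a :: l).length, (e i 1).toNat) =
        (e 0 1).toNat * ∏ i : Fin l.length, (e (i + 1) 1).toNat :=
      Fin.prod_univ_succ fun i : Fin (l.length + 1) => (e i 1).toNat
    have h1 := henc.packedDigit_eq hM (i := 0) (c := a) rfl hK
    have h2 : packedDigit a.e 1 - 9223372036854775808 = (e 0 1).toNat := by omega
    rw [this, h2]

theorem eq_succ_of_bool_rec {b : Bool} {x r : ℕ}
    (h : Bool.rec (motive := fun _ => ℕ) 0 x b = r + 1) : b = true ∧ x = r + 1 := by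
  cases b with
  | true => exact ⟨rfl, h⟩
  | false => exact absurd h (by simp)

/-- Both recursive calls run on matrices encoded with the enlarged bound, and their results add up
as in `volume_coneRegion_split`. The marks of the new column are arbitrary here. -/
theorem pivotStep_sound {n K D M : ℕ} {e : ℕ → ℕ → ℤ} {live : List ℕ} {cols : List PackedColumn}
    {ones ones' : ℕ} (hones : ones = ∑ k ∈ Finset.range K, 18446744073709551616 ^ k)
    {ih : List PackedColumn → ℕ → ℕ}
    (hih : ∀ (e : ℕ → ℕ → ℤ) (cols : List PackedColumn) (M r : ℕ), cols.length = n →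
      Encodes K M e cols → M < 9223372036854775808 → ih cols M = r + 1 →
      (D : ENNReal) * volume (coneRegion n e live) = r * volume (openSimplex n))
    (hlen : cols.length = n) (henc : Encodes K M e cols)
    {i j al be r : ℕ} {ci cj : PackedColumn} (hi : cols[i]? = some ci) (hj : cols[j]? = some cj)
    (hij : i ≠ j) (hal : 0 < al) (hbe : 0 < be)
    (h : pivotStep ones ones' (9223372036854775808 * ones) ih cols M i j al be ci cj = r + 1) :
    (D : ENNReal) * volume (coneRegion n e live) = r * volume (openSimplex n) := by
  have hlt : ∀ {i : ℕ} {c : PackedColumn}, cols[i]? = some c → i < n := by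
    intro i c hc
    by_contra hh
    rw [List.getElem?_eq_none (by omega)] at hc
    simp at hc
  simp only [pivotStep, natForce_eq, setColumn_eq] at h
  generalize hE : Nat.sub (Nat.add (Nat.add (Nat.mul al cj.e) (Nat.mul be ci.e))
    (9223372036854775808 * ones)) (Nat.mul (Nat.add al be) (9223372036854775808 * ones)) = E at h
  generalize Nat.mod (topMarks ones' (Nat.sub E ones)) _ = p at h
  generalize Nat.mod (Nat.sub ones' (topMarks ones' E)) _ = m at h
  cases hb : Nat.ble 9223372036854775808 (Nat.mul (Nat.add al be) M) with
  | true => 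
    erw [hb] at h
    exact absurd h (by simp)
  | false =>
    erw [hb] at h
    have hM' : (al + be) * M < 9223372036854775808 := by
      by_contra hc
      have : Nat.ble 9223372036854775808 ((al + be) * M) = true :=
          Nat.ble_eq_true_of_le (not_lt.1 hc)
      erw [hb] at this
      simp at this
    obtain ⟨a, b, ha, hb, rfl⟩ := combineValues_eq_succ h
    subst hones
    have h1 := hih _ _ _ _ (by simpa using hlen)
      (henc.set (c := ⟨E, p, m⟩) (E := E) hal hi hj hM' hE.symm rfl) hM' ha
    have hM'' : (be + al) * M < 9223372036854775808 := by rwa [add_comm]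
    have h2 := hih _ _ _ _ (by simpa using hlen)
      ((henc.set (c := ⟨E, p, m⟩) (E := E) hbe hj hi hM''
        (by rw [← hE, add_comm be al, add_comm (be * ci.e)]; rfl) rfl).mono
        (by rw [add_comm])) hM' hb
    rw [volume_coneRegion_split e live ⟨i, hlt hi⟩ ⟨j, hlt hj⟩ (by simpa using hij) al be hal hbe,
      mul_add, mul_left_comm _ (al : ENNReal), mul_left_comm _ (be : ENNReal), h1, h2]
    push_cast
    ring

theorem selectRow_elim {α : Type} {SP : ℕ} {k : ℕ → ℕ → α} {live : List ℕ} {b bp : ℕ} {x : α}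
    (h : selectRow SP k live b bp = x) : ∃ d p, (d ∈ live ∨ d = b) ∧ k d p = x := by
  obtain ⟨d, p, hd, h'⟩ := selectRow_spec SP k live b bp
  exact ⟨d, p, hd, h'.symm.trans h⟩

theorem selectNegative_elim {α : Type} {d : ℕ} {z : α} {k : ℕ → PackedColumn → α}
    {cols : List PackedColumn} {x : α} (h : selectNegative d z k cols 0 = x) :
    z = x ∨ ∃ j c, cols[j]? = some c ∧ k j c = x := by
  rcases selectNegative_spec d z k cols 0 with h' | ⟨j, c, hj, h'⟩
  · exact Or.inl (h'.symm.trans h)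
  · rw [zero_add] at h'
    exact Or.inr ⟨j, c, hj, h'.symm.trans h⟩

theorem selectPositive_elim {α : Type} {d pj t i : ℕ} {k : ℕ → PackedColumn → α}
    {cols : List PackedColumn} {ci : PackedColumn} {x : α} (hi : cols[i]? = some ci)
    (h : selectPositive d pj k cols 0 t i ci = x) : ∃ j c, cols[j]? = some c ∧ k j c = x := by
  rcases selectPositive_spec d pj k cols 0 t i ci with h' | ⟨j, c, hj, h'⟩
  · exact ⟨i, ci, hi, h'.symm.trans h⟩
  · rw [zero_add] at h'
    exact ⟨j, c, hj, h'.symm.trans h⟩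

theorem eq_succ_of_nat_rec {m x r : ℕ}
    (h : Nat.rec (motive := fun _ => ℕ) 0 (fun _ _ => x) m = r + 1) : 0 < m ∧ x = r + 1 := by
  cases m with
  | zero => exact absurd h (by simp)
  | succ m => exact ⟨m.succ_pos, h⟩

theorem natForce_elim {α : Type} {x : ℕ} {k : ℕ → α} {y : α} (h : natForce x k = y) : k x = y :=
  (natForce_eq x k).symm.trans h

theorem leaf_elim {D q r : ℕ} (h : (natForce q fun q =>
    Nat.rec (motive := fun _ => ℕ) (Nat.succ (Nat.div D q)) (fun _ _ => nat_lit 0) (Nat.mod D q)) =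
      r + 1) : q * r = D ∧ (q = 0 → r = 0) := by
  rw [natForce_eq] at h
  cases hmod : Nat.mod D q with
  | succ m =>
    rw [hmod] at h
    exact absurd h (by simp)
  | zero =>
    rw [hmod] at h
    have hr : D / q = r := Nat.succ.inj h
    rw [← hr]
    exact ⟨Nat.mul_div_cancel' (Nat.dvd_of_mod_eq_zero hmod), fun hq => by rw [hq, Nat.div_zero]⟩

theorem pivot_elim {a b r : ℕ} {k : ℕ → ℕ → ℕ} (h : (natForce a fun a => natForce b fun b =>
    natForce (Nat.gcd a b) fun g => natForce (Nat.div a g) fun al =>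
        natForce (Nat.div b g) fun be =>
      Nat.rec (motive := fun _ => ℕ) (nat_lit 0) (fun _ _ => k al be) (Nat.mul al be)) = r + 1) :
    0 < a ∧ 0 < b ∧ ∃ al be, 0 < al ∧ 0 < be ∧ k al be = r + 1 := by
  simp only [natForce_eq] at h
  obtain ⟨hm, h⟩ := eq_succ_of_nat_rec h
  have hal : 0 < a / Nat.gcd a b := Nat.pos_of_mul_pos_right hm
  have hbe : 0 < b / Nat.gcd a b := Nat.pos_of_mul_pos_left hm
  refine ⟨?_, ?_, _, _, hal, hbe, h⟩
  · by_contra hc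
    rw [Nat.eq_zero_of_not_pos hc, Nat.zero_div] at hal
    exact lt_irrefl _ hal
  · by_contra hc
    rw [Nat.eq_zero_of_not_pos hc, Nat.zero_div] at hbe
    exact lt_irrefl _ hbe

theorem coneVolumeStep_nil_elim {D ones ones' Ho M r : ℕ}
    {ih : List ℕ → List PackedColumn → ℕ → ℕ} {cols : List PackedColumn}
    (h : coneVolumeStep D ones ones' Ho ih [] cols M = r + 1) :
    weightProd cols * r = D ∧ (weightProd cols = 0 → r = 0) :=
  leaf_elim h

/-- The cases in which a row gets treated. -/
theorem coneVolumeStep_cons_elim {D ones ones' Ho M r a : ℕ} {l : List ℕ}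
    {ih : List ℕ → List PackedColumn → ℕ → ℕ} {cols : List PackedColumn}
    (h : coneVolumeStep D ones ones' Ho ih (a :: l) cols M = r + 1) :
    ∃ d ∈ a :: l, (rowNonpos d cols = true ∧ r = 0) ∨
      (rowNonneg d cols = true ∧ rowHasPos d cols = true ∧
        ih (removeRow d (a :: l)) cols M = r + 1) ∨
      ∃ i j al be ci cj, cols[i]? = some ci ∧ cols[j]? = some cj ∧
        0 < Nat.sub (packedDigit ci.e d) 9223372036854775808 ∧
        0 < Nat.sub 9223372036854775808 (packedDigit cj.e d) ∧ 0 < al ∧ 0 < be ∧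
        pivotStep ones ones' Ho (ih (a :: l)) cols M i j al be ci cj = r + 1 := by
  unfold coneVolumeStep at h
  replace h := natForce_elim h
  obtain ⟨d, p, hd, h⟩ := selectRow_elim h
  refine ⟨d, ?_, ?_⟩
  · rcases hd with hd | rfl
    · exact hd
    · simp
  cases p with
  | zero =>
    obtain ⟨hrow, h1⟩ := eq_succ_of_bool_rec h
    exact Or.inl ⟨hrow, (Nat.succ.inj h1).symm⟩
  | succ p =>
    rcases selectNegative_elim h with h | ⟨j, cj, hj, h⟩
    · obtain ⟨hge, h⟩ := eq_succ_of_bool_rec h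
      obtain ⟨hgt, h⟩ := eq_succ_of_bool_rec h
      exact Or.inr (Or.inl ⟨hge, hgt, h⟩)
    · obtain ⟨i, ci, hi, h⟩ := selectPositive_elim hj h
      obtain ⟨h1, h2, al, be, hal, hbe, h⟩ := pivot_elim h
      exact Or.inr (Or.inr ⟨i, j, al, be, ci, cj, hi, hj, h1, h2, hal, hbe, h⟩)

/-- If `coneVolume` succeeds, it computes the volume of the cone, in units of the volume of the
standard simplex divided by `D`. -/
theorem coneVolume_sound {n K D ones ones' : ℕ} (hK : 1 < K)
    (hones : ones = ∑ k ∈ Finset.range K, 18446744073709551616 ^ k) (f : ℕ) (live : List ℕ)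
    (hlive : ∀ k ∈ live, k < K) (e : ℕ → ℕ → ℤ) (cols : List PackedColumn) (M r : ℕ)
    (hlen : cols.length = n) (henc : Encodes K M e cols) (hM : M < 9223372036854775808)
    (h : coneVolume D ones ones' (9223372036854775808 * ones) f live cols M = r + 1) :
    (D : ENNReal) * volume (coneRegion n e live) = r * volume (openSimplex n) := by
  generalize hHo : 9223372036854775808 * ones = Ho at h
  induction f generalizing live e cols M r with
  | zero => exact absurd h (Nat.succ_ne_zero r).symm
  | succ f ih =>
    rw [coneVolume_succ] at h
    have hget : ∀ i : Fin n, ∃ c, cols[(i : ℕ)]? = some c ∧ c ∈ cols := fun i =>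
      ⟨cols[(i : ℕ)], by simp, List.getElem_mem _⟩
    have hidx : ∀ c ∈ cols, ∃ i : Fin n, cols[(i : ℕ)]? = some c := fun c hc => by
      obtain ⟨i, hi, rfl⟩ := List.getElem_of_mem hc
      exact ⟨⟨i, by omega⟩, by simp⟩
    cases live with
    | nil =>
      obtain ⟨hdvd, hq0⟩ := coneVolumeStep_nil_elim h
      rw [weightProd_spec hlen henc hM hK] at hdvd hq0
      generalize hq : ∏ i : Fin n, (e i 1).toNat = q at hdvd hq0
      -- A zero product of weights forces both `D` and `r` to vanish, and the identity is trivial.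
      rcases Nat.eq_zero_or_pos q with hq1 | hq1
      · have hD : D = 0 := by rw [← hdvd, hq1, zero_mul]
        simp [hD, hq0 hq1]
      · have hpos : ∀ i : Fin n, 0 < (e i 1).toNat := fun i => by
          rw [← hq] at hq1
          exact Nat.pos_of_ne_zero fun h0 => hq1.ne' (Finset.prod_eq_zero (Finset.mem_univ i) h0)
        have hv := volume_coneRegion_nil e (fun i : Fin n => (e i 1).toNat)
          (fun i => by have := hpos i; omega) hpos
        rw [hq] at hv
        rw [← hdvd, ← hv]
        push_cast
        ring
    | cons a l =>
      obtain ⟨d, hdl, ⟨hrow, hr⟩ | ⟨hge, hgt, h⟩ |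
        ⟨i, j, al, be, ci, cj, hi, hj, h1, h2, hal, hbe, h⟩⟩ := coneVolumeStep_cons_elim h
      · have hdK := hlive d hdl
        rw [coneRegion_eq_empty e _ hdl, hr]
        · simp
        · intro i
          obtain ⟨c, hc, hmem⟩ := hget i
          have h1 := rowNonpos_spec d cols hrow c hmem
          have h2 := henc.packedDigit_eq hM hc hdK
          omega
      · have hdK := hlive d hdl
        rw [coneRegion_congr e (a :: l) (removeRow d (a :: l)) d ?_ ?_
          (fun k => (mem_removeRow d (a :: l) k).1) (fun k => (mem_removeRow d (a :: l) k).2)]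
        · exact ih _ (fun k hk => hlive k ((mem_removeRow d (a :: l) k).1 hk)) e cols M r hlen
            henc hM h
        · intro i
          obtain ⟨c, hc, hmem⟩ := hget i
          have h1 := rowNonneg_spec d cols hge c hmem
          have h2 := henc.packedDigit_eq hM hc hdK
          omega
        · obtain ⟨c, hc, h1⟩ := rowHasPos_spec d cols hgt
          obtain ⟨i, hi⟩ := hidx c hc
          have h2 := henc.packedDigit_eq hM hi hdK
          exact ⟨i, by omega⟩
      · subst hHo
        refine pivotStep_sound hones (fun e cols M r h1 h2 h3 h4 =>
          ih _ hlive e cols M r h1 h2 h3 h4) hlen henc hi hj ?_ hal hbe h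
        -- One column cannot be both positive and negative in row `d`.
        rintro rfl
        have hcc : ci = cj := by rw [hi] at hj; exact Option.some.inj hj
        subst hcc
        have h1 := Nat.lt_of_sub_pos h1
        have h2 := Nat.lt_of_sub_pos h2
        exact absurd (h1.trans h2) (lt_irrefl _)

end Soundness

/-! ### From integer lists to packed columns -/

section Packing

theorem packDigits_cons (x : ℤ) (l : List ℤ) : packDigits (x :: l) =
    (x + 9223372036854775808).toNat + 18446744073709551616 * packDigits l := rfl

theorem packDigits_eq_sum (l : List ℤ) (hl : ∀ x ∈ l, -9223372036854775808 ≤ x) :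
    (packDigits l : ℤ) = ∑ k ∈ Finset.range l.length,
      (l.getD k 0 + 9223372036854775808) * 18446744073709551616 ^ k := by
  induction l with
  | nil => simp [packDigits]
  | cons x l ih =>
    have hx : -9223372036854775808 ≤ x := hl x (by simp)
    rw [packDigits_cons, List.length_cons, Finset.sum_range_succ', Nat.cast_add, Nat.cast_mul,
      ih fun y hy => hl y (by simp [hy]), Int.toNat_of_nonneg (by omega)]
    simp only [List.getD_cons_succ, List.getD_cons_zero, pow_zero, mul_one, Finset.mul_sum,
        pow_succ]
    rw [add_comm]
    congr 1
    refine Finset.sum_congr rfl fun k _ => ?_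
    push_cast
    ring

theorem packDigits_replicate (K : ℕ) :
    packDigits (List.replicate K (-9223372036854775807)) =
      ∑ k ∈ Finset.range K, 18446744073709551616 ^ k := by
  have h := packDigits_eq_sum (List.replicate K (-9223372036854775807)) (fun x hx => by
    rw [List.eq_of_mem_replicate hx]; norm_num)
  rw [List.length_replicate] at h
  have h2 : (packDigits (List.replicate K (-9223372036854775807)) : ℤ) =
      ((∑ k ∈ Finset.range K, 18446744073709551616 ^ k : ℕ) : ℤ) := by
    rw [h]
    push_cast
    refine Finset.sum_congr rfl fun k hk => ?_
    rw [List.getD_eq_getElem _ _ (by simpa using hk)]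
    simp
  exact_mod_cast h2

theorem packColumns_eq {α : Type} (ls : List (List ℤ)) : ∃ f : List ℤ → PackedColumn,
    (∀ l, (f l).e = packDigits (augment l)) ∧
    ∀ k : List PackedColumn → α, packColumns ls k = k (ls.map f) := by
  refine ⟨fun l => ⟨packDigits (augment l), 16 * packMarks (fun x => 0 < x) (augment l).tail,
    16 * packMarks (fun x => x < 0) (augment l).tail⟩, fun l => rfl, ?_⟩
  induction ls with
  | nil => intro k; rfl
  | cons l ls ih =>
    intro k
    unfold packColumns
    dsimp only
    rw [natForce_eq, natForce_eq, natForce_eq]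
    exact ih _

/-- The part below `∑ i, x i = 1` of the open cone cut out of the positive orthant by linear forms:
the list `ls` holds the lists of the coefficients of the single variables. -/
def matrixCone (n R : ℕ) (ls : List (List ℤ)) : Set (Fin n → ℝ) :=
  {x | (∀ i, 0 < x i) ∧
    (∀ k < R, 0 < ∑ i : Fin n, (((ls.getD i []).getD k 0 : ℤ) : ℝ) * x i) ∧ ∑ i, x i < 1}

/-- At the start all weights are 1, so row 1 expresses that the coordinate sum is below 1. -/
theorem volume_matrixCone {D R n r : ℕ} {ls : List (List ℤ)} (hn : ls.length = n)
    (hR : ∀ l ∈ ls, l.length = R) (hM : ∀ l ∈ ls, ∀ x ∈ augment l, |x| ≤ 1048576)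
    (h : matrixConeVolume D R ls = r + 1) :
    (D : ENNReal) * volume (matrixCone n R ls) = r * volume (openSimplex n) := by
  unfold matrixConeVolume at h
  replace h := natForce_elim h
  replace h := natForce_elim h
  replace h := natForce_elim h
  obtain ⟨f, hf, hpack⟩ := packColumns_eq (α := ℕ) ls
  rw [hpack] at h
  set e : ℕ → ℕ → ℤ := fun i k => (augment (ls.getD i [])).getD k 0 with he
  have hgetD : ∀ i : Fin n, ls.getD i [] ∈ ls := fun i => by
    rw [List.getD_eq_getElem _ _ (by omega)]
    exact List.getElem_mem _
  have hset : matrixCone n R ls = coneRegion n e ((List.range R).map fun k => k + 2) := by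
    ext x
    simp [matrixCone, coneRegion, he, augment]
  rw [hset]
  refine coneVolume_sound (K := R + 2) (by omega) (packDigits_replicate (R + 2)) 100 _ ?_ e
    (ls.map f) 1048576 r (by simpa using hn) ?_ (by norm_num) h
  · simp
  · intro i c hc
    rw [List.getElem?_map, Option.map_eq_some_iff] at hc
    obtain ⟨l, hl, rfl⟩ := hc
    have hmem : l ∈ ls := List.mem_of_getElem? hl
    have hl' : ls.getD i [] = l := by rw [List.getD_eq_getElem?_getD, hl]; rfl
    have hlen : (augment l).length = R + 2 := by simp [augment, hR l hmem]
    constructor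
    · rw [hf, packDigits_eq_sum _ fun x hx => by have := abs_le.1 (hM l hmem x hx); omega, hlen]
      simp only [he, hl']
    · intro k hk
      simp only [he, hl']
      rw [List.getD_eq_getElem _ _ (by omega)]
      exact hM l hmem _ (List.getElem_mem _)

end Packing

/-! ### Cones and their slices by hyperplanes of constant coordinate sum -/

section Slices

open scoped Pointwise

/-- Replacing the first coordinate by the coordinate sum is, for fixed other coordinates, a
translation; Fubini does the rest. -/
theorem volume_eq_lintegral_slices {m : ℕ} {X : Set (Fin (m + 1) → ℝ)} (hX : MeasurableSet X) :
    volume X = ∫⁻ s : ℝ, volume {y : Fin m → ℝ | (Fin.cons (s - ∑ i,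
        y i) y : Fin (m + 1) → ℝ) ∈ X} := by
  have hp := volume_preserving_piFinSuccAbove (fun _ : Fin (m + 1) => ℝ) 0
  have hcons : Measurable fun p : ℝ × (Fin m → ℝ) => (Fin.cons p.1 p.2 : Fin (m + 1) → ℝ) := by
    refine measurable_pi_lambda _ fun i => ?_
    refine Fin.cases ?_ (fun i => ?_) i
    · simpa using measurable_fst
    · simp only [Fin.cons_succ]; fun_prop
  set Y : Set (ℝ × (Fin m → ℝ)) := {p | (Fin.cons p.1 p.2 : Fin (m + 1) → ℝ) ∈ X} with hY
  have hYm : MeasurableSet Y := hcons hX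
  have h1 : volume X = volume Y := by
    rw [← hp.measure_preimage hYm.nullMeasurableSet]
    congr 1
    ext x
    simp only [hY, Set.mem_preimage, Set.mem_ofPred_eq, MeasurableEquiv.piFinSuccAbove_apply]
    simp
  set Z : Set (ℝ × (Fin m → ℝ)) :=
    {p | (Fin.cons (p.1 - ∑ i, p.2 i) p.2 : Fin (m + 1) → ℝ) ∈ X} with hZ
  have hZm : MeasurableSet Z := by
    have : Measurable fun p : ℝ × (Fin m → ℝ) => (p.1 - ∑ i, p.2 i, p.2) := by fun_prop
    exact this hYm
  have h2 : volume Y = volume Z := by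
    rw [Measure.volume_eq_prod, Measure.prod_apply_symm hYm, Measure.prod_apply_symm hZm]
    refine lintegral_congr fun y => ?_
    exact ((measurePreserving_sub_right volume (∑ i, y i)).measure_preimage
      (hYm.preimage measurable_prodMk_right).nullMeasurableSet).symm
  rw [h1, h2, Measure.volume_eq_prod, Measure.prod_apply hZm]
  rfl

/-- The point of the hyperplane `∑ i, x i = 1` over `y`. -/
def sliceMap (m : ℕ) (y : Fin m → ℝ) : Fin (m + 1) → ℝ := Fin.cons (1 - ∑ i, y i) y

/-- The volume of a cone is proportional to the volume of its slice. -/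
theorem volume_cone_eq {m : ℕ} {A : Set (Fin (m + 1) → ℝ)} (hA : MeasurableSet A)
    (hcone : ∀ t : ℝ, 0 < t → ∀ x, t • x ∈ A ↔ x ∈ A) :
    volume (A ∩ {x | 0 < ∑ i, x i ∧ ∑ i, x i < 1}) =
      (∫⁻ s in Set.Ioo (0 : ℝ) 1, ENNReal.ofReal (s ^ m)) * volume (sliceMap m ⁻¹' A) := by
  have hm : MeasurableSet (A ∩ {x | 0 < ∑ i, x i ∧ ∑ i, x i < 1}) :=
    hA.inter (measurableSet_Ioo.preimage
      (f := fun x : Fin (m + 1) → ℝ => ∑ i, x i) (by fun_prop))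
  rw [volume_eq_lintegral_slices hm, ← lintegral_mul_const _ (by fun_prop),
    ← lintegral_indicator measurableSet_Ioo]
  refine lintegral_congr fun s => ?_
  by_cases hs : s ∈ Set.Ioo (0 : ℝ) 1
  · rw [Set.indicator_of_mem hs]
    have hs0 := hs.1
    -- The slice at height `s` is `s` times the slice at height 1, which yields the factor `s ^ m`.
    have : {y : Fin m → ℝ | (Fin.cons (s - ∑ i, y i) y : Fin (m + 1) → ℝ) ∈
        A ∩ {x | 0 < ∑ i, x i ∧ ∑ i, x i < 1}} = s • (sliceMap m ⁻¹' A) := by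
      ext y
      rw [Set.mem_smul_set_iff_inv_smul_mem₀ hs0.ne', Set.mem_preimage, ← hcone s hs0]
      have h1 : s • sliceMap m (s⁻¹ • y) = Fin.cons (s - ∑ i, y i) y := by
        funext i
        refine Fin.cases ?_ (fun i => ?_) i
        · simp only [sliceMap, Pi.smul_apply, Fin.cons_zero, smul_eq_mul, ← Finset.mul_sum]
          field_simp
        · simp only [sliceMap, Pi.smul_apply, Fin.cons_succ, smul_eq_mul]
          field_simp
      rw [h1]
      simp [Fin.sum_univ_succ, hs.1, hs.2]
    rw [this, Measure.addHaar_smul]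
    simp [abs_of_pos hs0]
  · rw [Set.indicator_of_notMem hs]
    have : {y : Fin m → ℝ | (Fin.cons (s - ∑ i, y i) y : Fin (m + 1) → ℝ) ∈
        A ∩ {x | 0 < ∑ i, x i ∧ ∑ i, x i < 1}} = ∅ := by
      ext y
      simp only [Set.mem_ofPred_eq, Set.mem_inter_iff, Fin.sum_univ_succ, Fin.cons_zero,
        Fin.cons_succ, sub_add_cancel, Set.mem_empty_iff_false, iff_false]
      exact fun h => hs h.2
    rw [this, measure_empty]

/-- With finiteness, this lets the common factor be cancelled when two cones are compared. -/
theorem lintegral_pow_ne_zero (m : ℕ) :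
    ∫⁻ s in Set.Ioo (0 : ℝ) 1, ENNReal.ofReal (s ^ m) ≠ 0 := by
  rw [← pos_iff_ne_zero, setLIntegral_pos_iff (by fun_prop)]
  have : (Function.support fun s : ℝ => ENNReal.ofReal (s ^ m)) ∩ Set.Ioo 0 1 = Set.Ioo 0 1 := by
    refine Set.inter_eq_right.2 fun s hs => ?_
    simpa using pow_pos hs.1 m
  rw [this]
  simp

theorem lintegral_pow_ne_top (m : ℕ) :
    ∫⁻ s in Set.Ioo (0 : ℝ) 1, ENNReal.ofReal (s ^ m) ≠ ⊤ := by
  refine ne_top_of_le_ne_top (b := ∫⁻ s in Set.Ioo (0 : ℝ) 1, 1) (by simp) ?_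
  refine setLIntegral_mono (by fun_prop) fun s hs => ?_
  rw [← ENNReal.ofReal_one]
  exact ENNReal.ofReal_le_ofReal (pow_le_one₀ hs.1.le hs.2.le)

end Slices

/-! ### Counting compositions as lattice points -/

section Lattice

open scoped Pointwise

/-- The compositions of `V` into `n` parts with the property `F`. -/
noncomputable def countCompositions (n : ℕ) (F : (Fin n → ℕ) → Prop) (V : ℕ) : ℕ :=
  {z : Fin n → ℕ | ∑ i, z i = V ∧ F z}.ncard

theorem finite_compositions (n : ℕ) (F : (Fin n → ℕ) → Prop) (V : ℕ) :
    {z : Fin n → ℕ | ∑ i, z i = V ∧ F z}.Finite :=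
  (Finset.finite_toSet (Finset.univ.piAntidiag V)).subset fun z hz => by
    simpa using hz.1

theorem countCompositions_mono {n : ℕ} {F G : (Fin n → ℕ) → Prop} {V : ℕ}
    (h : ∀ z, ∑ i, z i = V → F z → G z) : countCompositions n F V ≤ countCompositions n G V :=
  Set.ncard_le_ncard (fun z hz => ⟨hz.1, h z hz.1 hz.2⟩) (finite_compositions n G V)

/-- The total determines part 0. Dropping it turns compositions into points of the lattice of mesh
1/V, and nonnegativity on `A` ensures that every lattice point comes from natural numbers. -/
theorem card_lattice_eq_countCompositions {m V : ℕ} (hV : V ≠ 0) {A : Set (Fin (m + 1) → ℝ)}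
    (hA : ∀ x ∈ A, ∀ i, 0 ≤ x i) :
    Nat.card ↑(sliceMap m ⁻¹' A ∩
      (V : ℝ)⁻¹ • (Submodule.span ℤ (Set.range (Pi.basisFun ℝ (Fin m))) : Set (Fin m → ℝ))) =
      countCompositions (m + 1) (fun z => (fun i => (z i : ℝ) / V) ∈ A) V := by
  have hV0 : (V : ℝ) ≠ 0 := by exact_mod_cast hV
  have : NeZero V := ⟨hV⟩
  have hslice : ∀ z : Fin (m + 1) → ℕ, ∑ i, z i = V →
      sliceMap m (fun i => (z i.succ : ℝ) / V) = fun i => (z i : ℝ) / V := by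
    intro z hz
    funext i
    refine Fin.cases ?_ (fun i => ?_) i
    · simp only [sliceMap, Fin.cons_zero]
      rw [Fin.sum_univ_succ] at hz
      rw [← Finset.sum_div, eq_div_iff hV0, sub_mul, div_mul_cancel₀ _ hV0, ← hz]
      push_cast
      ring
    · simp [sliceMap]
  rw [Nat.card_coe_set_eq, countCompositions]
  symm
  refine Set.ncard_congr (fun z _ i => (z i.succ : ℝ) / V) ?_ ?_ ?_
  · rintro z ⟨hz, hzA⟩
    refine ⟨?_, ?_⟩
    · rw [Set.mem_preimage, hslice z hz]; exact hzA
    · exact (BoxIntegral.unitPartition.mem_smul_span_iff (n := V)).2 fun i =>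
        ⟨(z i.succ : ℤ), by simp [mul_div_cancel₀ _ hV0]⟩
  · rintro z w ⟨hz, -⟩ ⟨hw, -⟩ h
    have h2 := (hslice z hz).symm.trans ((congrArg (sliceMap m) h).trans (hslice w hw))
    funext i
    have := congrFun h2 i
    simp only [div_left_inj' hV0] at this
    exact_mod_cast this
  · rintro y ⟨hyA, hyL⟩
    have hyL := (BoxIntegral.unitPartition.mem_smul_span_iff (n := V)).1 hyL
    choose u hu using hyL
    simp only [algebraMap_int_eq, eq_intCast] at hu
    have hpos := hA _ hyA
    have hy0 : ∀ i, 0 ≤ u i := fun i => by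
      have h1 := hpos i.succ
      simp only [sliceMap, Fin.cons_succ] at h1
      have : (0 : ℝ) ≤ u i := by rw [hu i]; positivity
      exact_mod_cast this
    have hsum : ∑ i, u i ≤ (V : ℤ) := by
      have h1 := hpos 0
      simp only [sliceMap, Fin.cons_zero, sub_nonneg] at h1
      have : ((∑ i, u i : ℤ) : ℝ) ≤ (V : ℝ) := by
        push_cast
        simp only [hu, ← Finset.mul_sum]
        exact mul_le_of_le_one_right (by positivity) h1
      exact_mod_cast this
    let z : Fin (m + 1) → ℕ := Fin.cons (V - ∑ i, u i).toNat fun i => (u i).toNat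
    have hz : ∑ i, z i = V := by
      rw [Fin.sum_univ_succ]
      simp only [z, Fin.cons_zero, Fin.cons_succ]
      zify
      rw [Int.toNat_of_nonneg (by omega)]
      simp only [Int.toNat_of_nonneg (hy0 _)]
      ring
    have hzy : (fun i : Fin m => (z i.succ : ℝ) / V) = y := by
      funext i
      simp only [z, Fin.cons_succ]
      have h1 : (((u i).toNat : ℕ) : ℝ) = u i := by
        have := Int.toNat_of_nonneg (hy0 i)
        exact_mod_cast this
      rw [h1, hu i, mul_div_cancel_left₀ _ hV0]
    refine ⟨z, ⟨hz, ?_⟩, hzy⟩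
    have := hslice z hz
    rw [hzy] at this
    rw [← this]
    exact hyA

theorem sliceMap_isBounded {m : ℕ} {A : Set (Fin (m + 1) → ℝ)} (hA : ∀ x ∈ A, ∀ i, 0 ≤ x i) :
    Bornology.IsBounded (sliceMap m ⁻¹' A) := by
  refine (Metric.isBounded_Icc (0 : Fin m → ℝ) 1).subset fun y hy => ?_
  have h := hA _ hy
  have h0 := h 0
  have hs : ∀ i, 0 ≤ y i := fun i => by simpa [sliceMap] using h i.succ
  simp only [sliceMap, Fin.cons_zero, sub_nonneg] at h0
  exact ⟨hs, fun i => (Finset.single_le_sum (fun i _ => hs i) (Finset.mem_univ i)).trans h0⟩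

theorem continuous_sliceMap (m : ℕ) : Continuous (sliceMap m) := by
  refine continuous_pi fun i => ?_
  refine Fin.cases ?_ (fun i => ?_) i
  · simp only [sliceMap, Fin.cons_zero]; fun_prop
  · simp only [sliceMap, Fin.cons_succ]; fun_prop

theorem sliceMap_convex {m : ℕ} {A : Set (Fin (m + 1) → ℝ)} (hA : Convex ℝ A) :
    Convex ℝ (sliceMap m ⁻¹' A) := by
  intro x hx y hy a b ha hb hab
  rw [Set.mem_preimage]
  have : sliceMap m (a • x + b • y) = a • sliceMap m x + b • sliceMap m y := by
    funext i
    refine Fin.cases ?_ (fun i => ?_) i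
    · simp only [sliceMap, Fin.cons_zero, Pi.add_apply, Pi.smul_apply, smul_eq_mul,
        Finset.sum_add_distrib, ← Finset.mul_sum]
      linear_combination (-1 : ℝ) * hab
    · simp [sliceMap]
  rw [this]
  exact hA hx hy ha hb hab

theorem tendsto_countCompositions {m : ℕ} {A : Set (Fin (m + 1) → ℝ)}
    (hA : ∀ x ∈ A, ∀ i, 0 ≤ x i) (hconv : Convex ℝ A) (hclosed : IsClosed A) :
    Tendsto (fun V : ℕ =>
      (countCompositions (m + 1) (fun z => (fun i => (z i : ℝ) / V) ∈ A) V : ℝ) / V ^ m) atTop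
      (𝓝 (volume.real (sliceMap m ⁻¹' A))) := by
  have h := tendsto_card_div_pow_atTop_volume (sliceMap m ⁻¹' A) (sliceMap_isBounded hA)
    (hclosed.preimage (continuous_sliceMap m)).measurableSet
    ((sliceMap_convex hconv).addHaar_frontier volume)
  refine h.congr' ?_
  filter_upwards [eventually_ne_atTop 0] with V hV
  rw [← card_lattice_eq_countCompositions hV hA, Fintype.card_fin]

end Lattice

/-! ### Limits of counts as ratios of cone volumes -/

section Limits

/-- The part of the cone with inequalities `a` in the positive orthant on which all forms are
at least `δ`. -/
def coneAbove {n : ℕ} (R : ℕ) (a : ℕ → Fin n → ℤ) (δ : ℝ) : Set (Fin n → ℝ) :=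
  {x | (∀ i, δ ≤ x i) ∧ ∀ k < R, δ ≤ ∑ i, (a k i : ℝ) * x i}

/-- The open cone with inequalities `a` in the positive orthant. -/
def openCone {n : ℕ} (R : ℕ) (a : ℕ → Fin n → ℤ) : Set (Fin n → ℝ) :=
  {x | (∀ i, 0 < x i) ∧ ∀ k < R, 0 < ∑ i, (a k i : ℝ) * x i}

theorem coneAbove_eq_inter {n : ℕ} (R : ℕ) (a : ℕ → Fin n → ℤ) (δ : ℝ) :
    coneAbove R a δ = (⋂ i, {x : Fin n → ℝ | δ ≤ x i}) ∩
      ⋂ k, ⋂ (_ : k < R), {x : Fin n → ℝ | δ ≤ ∑ i, (a k i : ℝ) * x i} := by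
  ext x
  simp [coneAbove]

theorem isClosed_coneAbove {n : ℕ} (R : ℕ) (a : ℕ → Fin n → ℤ) (δ : ℝ) :
    IsClosed (coneAbove R a δ) := by
  rw [coneAbove_eq_inter]
  exact (isClosed_iInter fun i => isClosed_le (by fun_prop) (by fun_prop)).inter
    (isClosed_iInter fun k => isClosed_iInter fun _ => isClosed_le (by fun_prop) (by fun_prop))

theorem convex_coneAbove {n : ℕ} (R : ℕ) (a : ℕ → Fin n → ℤ) (δ : ℝ) :
    Convex ℝ (coneAbove R a δ) := by
  rintro x ⟨hx, hx'⟩ y ⟨hy, hy'⟩ s t hs ht hst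
  have key : ∀ u v : ℝ, δ ≤ u → δ ≤ v → δ ≤ s * u + t * v := fun u v hu hv => by
    calc δ = s * δ + t * δ := by rw [← add_mul, hst, one_mul]
      _ ≤ s * u + t * v := by gcongr
  refine ⟨fun i => key _ _ (hx i) (hy i), fun k hk => ?_⟩
  convert key _ _ (hx' k hk) (hy' k hk) using 1
  simp only [Pi.add_apply, Pi.smul_apply, smul_eq_mul, Finset.mul_sum, ← Finset.sum_add_distrib]
  exact Finset.sum_congr rfl fun i _ => by ring

theorem measurableSet_openCone {n : ℕ} (R : ℕ) (a : ℕ → Fin n → ℤ) :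
    MeasurableSet (openCone R a) := by
  have : openCone R a = (⋂ i, {x : Fin n → ℝ | 0 < x i}) ∩
      ⋂ k, ⋂ (_ : k < R), {x : Fin n → ℝ | 0 < ∑ i, (a k i : ℝ) * x i} := by
    ext x
    simp [openCone]
  rw [this]
  exact (MeasurableSet.iInter fun i => measurableSet_lt (by fun_prop) (by fun_prop)).inter
    (MeasurableSet.iInter fun k => MeasurableSet.iInter fun _ =>
      measurableSet_lt (by fun_prop) (by fun_prop))

theorem coneAbove_ae_eq_openCone {n R : ℕ} {a : ℕ → Fin n → ℤ} (ha : ∀ k < R, a k ≠ 0) :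
    (coneAbove R a 0 : Set (Fin n → ℝ)) =ᵐ[volume] openCone R a := by
  have h1 : ∀ᵐ x : Fin n → ℝ, ∀ i, x i ≠ 0 := by
    refine ae_all_iff.2 fun i => ?_
    rw [ae_iff]
    have h := volume_hyperplane (Pi.single i (1 : ℝ)) (by simp)
    simpa [Pi.single_apply] using h
  have h2 : ∀ᵐ x : Fin n → ℝ, ∀ k < R, ∑ i, (a k i : ℝ) * x i ≠ 0 := by
    refine ae_all_iff.2 fun k => ?_
    by_cases hk : k < R
    · have h := volume_hyperplane (fun i => (a k i : ℝ)) (fun h => ha k hk (by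
        funext i; have := congrFun h i; simpa using this))
      rw [ae_iff]
      simpa [hk] using h
    · simp [hk]
  filter_upwards [h1, h2] with x hx1 hx2
  apply propext
  exact ⟨fun h => ⟨fun i => lt_of_le_of_ne (h.1 i) (hx1 i).symm,
    fun k hk => lt_of_le_of_ne (h.2 k hk) (hx2 k hk).symm⟩,
    fun h => ⟨fun i => (h.1 i).le, fun k hk => (h.2 k hk).le⟩⟩

theorem smul_mem_openCone {n R : ℕ} {a : ℕ → Fin n → ℤ} {t : ℝ} (ht : 0 < t) (x : Fin n → ℝ) :
    t • x ∈ openCone R a ↔ x ∈ openCone R a := by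
  simp only [openCone, Set.mem_ofPred_eq, Pi.smul_apply, smul_eq_mul, mul_left_comm _ t,
    ← Finset.mul_sum, mul_pos_iff_of_pos_left ht]

theorem smul_mem_coneAbove {n R : ℕ} {a : ℕ → Fin n → ℤ} {t : ℝ} (ht : 0 < t) (x : Fin n → ℝ) :
    t • x ∈ coneAbove R a 0 ↔ x ∈ coneAbove R a 0 := by
  simp only [coneAbove, Set.mem_ofPred_eq, Pi.smul_apply, smul_eq_mul, mul_left_comm _ t,
    ← Finset.mul_sum, mul_nonneg_iff_of_pos_left ht]

theorem volume_slice_coneAbove {m R : ℕ} {a : ℕ → Fin (m + 1) → ℤ} (ha : ∀ k < R, a k ≠ 0) :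
    volume (sliceMap m ⁻¹' coneAbove R a 0) = volume (sliceMap m ⁻¹' openCone R a) := by
  have h1 := volume_cone_eq (isClosed_coneAbove R a 0).measurableSet
    fun t ht x => smul_mem_coneAbove ht x
  have h2 := volume_cone_eq (measurableSet_openCone R a) fun t ht x => smul_mem_openCone ht x
  have h3 : volume (coneAbove R a 0 ∩ {x | 0 < ∑ i, x i ∧ ∑ i, x i < 1}) =
      volume (openCone R a ∩ {x | 0 < ∑ i, x i ∧ ∑ i, x i < 1}) :=
    measure_congr ((coneAbove_ae_eq_openCone ha).inter (ae_eq_refl _))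
  rw [h1, h2] at h3
  exact (ENNReal.mul_right_inj (lintegral_pow_ne_zero m) (lintegral_pow_ne_top m)).1 h3

/-- The shrunken cones increase to the open cone as δ decreases to 0, so continuity from below
applies. -/
theorem tendsto_volume_slice_coneAbove {m R : ℕ} (a : ℕ → Fin (m + 1) → ℤ) :
    Tendsto (fun j : ℕ => volume.real (sliceMap m ⁻¹' coneAbove R a (1 / ((j : ℝ) + 1)))) atTop
      (𝓝 (volume.real (sliceMap m ⁻¹' openCone R a))) := by
  have hU : sliceMap m ⁻¹' openCone R a =
      ⋃ j : ℕ, sliceMap m ⁻¹' coneAbove R a (1 / ((j : ℝ) + 1)) := by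
    ext y
    simp only [Set.mem_preimage, Set.mem_iUnion]
    generalize sliceMap m y = x
    constructor
    · rintro ⟨h1, h2⟩
      have hev : ∀ c : ℝ, 0 < c → ∀ᶠ j : ℕ in atTop, 1 / ((j : ℝ) + 1) ≤ c := fun c hc =>
        (tendsto_one_div_add_atTop_nhds_zero_nat.eventually (gt_mem_nhds hc)).mono fun _ => le_of_lt
      have e1 := eventually_all.2 fun i => hev _ (h1 i)
      have e2 : ∀ᶠ j : ℕ in atTop, ∀ k ∈ Finset.range R,
          1 / ((j : ℝ) + 1) ≤ ∑ i, (a k i : ℝ) * x i :=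
        (Filter.eventually_all_finset _).2 fun k hk => hev _ (h2 k (Finset.mem_range.1 hk))
      obtain ⟨j, h1, h2⟩ := (e1.and e2).exists
      exact ⟨j, h1, fun k hk => h2 k (Finset.mem_range.2 hk)⟩
    · rintro ⟨j, h1, h2⟩
      have hj : (0 : ℝ) < 1 / ((j : ℝ) + 1) := by positivity
      exact ⟨fun i => hj.trans_le (h1 i), fun k hk => hj.trans_le (h2 k hk)⟩
  have hmono : Monotone fun j : ℕ => sliceMap m ⁻¹' coneAbove R a (1 / ((j : ℝ) + 1)) := by
    intro i j hij y hy
    have : 1 / ((j : ℝ) + 1) ≤ 1 / ((i : ℝ) + 1) := by gcongr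
    exact ⟨fun i => this.trans (hy.1 i), fun k hk => this.trans (hy.2 k hk)⟩
  have hfin : volume (sliceMap m ⁻¹' openCone R a) ≠ ⊤ :=
    (sliceMap_isBounded fun x hx i => (hx.1 i).le).measure_lt_top.ne
  have h := tendsto_measure_iUnion_atTop (μ := volume) hmono
  rw [← hU] at h
  exact (ENNReal.tendsto_toReal hfin).comp h

/-- The asymptotics of the number of compositions with a property that is, up to a bounded
distance from the boundary, membership in a cone. -/
theorem tendsto_countCompositions_cone {m R : ℕ} {a : ℕ → Fin (m + 1) → ℤ}
    (ha : ∀ k < R, a k ≠ 0) {F : (Fin (m + 1) → ℕ) → Prop} (K : ℤ)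
    (hF : ∀ z, F z → ∀ k < R, 0 ≤ ∑ i, a k i * z i)
    (hF' : ∀ z, (∀ i, K ≤ z i) → (∀ k < R, K ≤ ∑ i, a k i * z i) → F z) :
    Tendsto (fun V : ℕ => (countCompositions (m + 1) F V : ℝ) / V ^ m) atTop
      (𝓝 (volume.real (sliceMap m ⁻¹' openCone R a))) := by
  have hlim : ∀ δ : ℝ, 0 ≤ δ → _ := fun δ hδ => tendsto_countCompositions (A := coneAbove R a δ)
    (fun x hx i => hδ.trans (hx.1 i)) (convex_coneAbove R a δ) (isClosed_coneAbove R a δ)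
  have hsum : ∀ (z : Fin (m + 1) → ℕ) (V : ℕ) (k : ℕ),
      ∑ i, (a k i : ℝ) * ((z i : ℝ) / V) = ((∑ i, a k i * z i : ℤ) : ℝ) / V := by
    intro z V k
    push_cast
    rw [Finset.sum_div]
    exact Finset.sum_congr rfl fun i _ => by ring
  -- Lower bound: fix δ > 0 with almost the full slice volume; once δV ≥ K the shrunken cone lies in
  -- the event. Upper bound: the event lies in the closed cone, which differs from the open one by a
  -- null set.
  rw [tendsto_order]
  constructor
  · intro b hb
    obtain ⟨j, hj⟩ := ((tendsto_volume_slice_coneAbove a).eventually (lt_mem_nhds hb)).exists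
    set δ : ℝ := 1 / ((j : ℝ) + 1) with hδ
    have hδ0 : 0 < δ := by positivity
    have hVK : ∀ᶠ V : ℕ in atTop, (K : ℝ) ≤ δ * V :=
      (tendsto_natCast_atTop_atTop.const_mul_atTop hδ0).eventually_ge_atTop _
    filter_upwards [(hlim δ hδ0.le).eventually (lt_mem_nhds hj), hVK, eventually_gt_atTop 0]
      with V h1 h2 h3
    refine h1.trans_le ?_
    gcongr
    have hV : (0 : ℝ) < V := by exact_mod_cast h3
    refine countCompositions_mono fun z _ ⟨hz1, hz2⟩ => hF' z (fun i => ?_) fun k hk => ?_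
    · have := (le_div_iff₀ hV).1 (hz1 i)
      exact_mod_cast h2.trans this
    · have h := hz2 k hk
      rw [hsum] at h
      have := (le_div_iff₀ hV).1 h
      exact_mod_cast h2.trans this
  · intro b hb
    have h0 := hlim 0 le_rfl
    rw [measureReal_def, volume_slice_coneAbove ha, ← measureReal_def] at h0
    filter_upwards [h0.eventually (gt_mem_nhds hb)] with V h1
    refine lt_of_le_of_lt ?_ h1
    gcongr
    refine countCompositions_mono fun z _ hz => ⟨fun i => by positivity, fun k hk => ?_⟩
    rw [hsum]
    have : (0 : ℝ) ≤ ((∑ i, a k i * z i : ℤ) : ℝ) := by exact_mod_cast hF z hz k hk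
    positivity

theorem volume_slice_positive (m : ℕ) (a : ℕ → Fin (m + 1) → ℤ) :
    0 < volume.real (sliceMap m ⁻¹' openCone 0 a) := by
  rw [measureReal_def, ENNReal.toReal_pos_iff]
  refine ⟨?_, (sliceMap_isBounded fun x hx i => (hx.1 i).le).measure_lt_top⟩
  have ho : IsOpen (sliceMap m ⁻¹' openCone 0 a) := by
    have : openCone 0 a = ⋂ i, {x : Fin (m + 1) → ℝ | 0 < x i} := by
      ext x
      simp [openCone]
    rw [this]
    exact (isOpen_iInter_of_finite fun i => isOpen_lt (by fun_prop) (by fun_prop)).preimage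
      (continuous_sliceMap m)
  refine ho.measure_pos volume ⟨fun _ => 1 / (m + 1), ?_, by simp⟩
  intro i
  refine Fin.cases ?_ (fun i => ?_) i
  · have hm : (0 : ℝ) < m + 1 := by positivity
    simp only [sliceMap, Fin.cons_zero, Finset.sum_const, Finset.card_univ, Fintype.card_fin,
      nsmul_eq_mul, sub_pos]
    rw [mul_one_div, div_lt_one hm]
    linarith
  · simp only [sliceMap, Fin.cons_succ]
    positivity

theorem volume_slice_ratio {m R D r : ℕ} {a : ℕ → Fin (m + 1) → ℤ} (hD : 0 < D)
    (h : (D : ENNReal) * volume (openCone R a ∩ {x | ∑ i, x i < 1}) =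
      r * volume (openSimplex (m + 1))) :
    volume.real (sliceMap m ⁻¹' openCone R a) =
      (r / D : ℝ) * volume.real (sliceMap m ⁻¹' openCone 0 a) := by
  have hset : ∀ R, openCone R a ∩ {x | ∑ i, x i < 1} =
      openCone R a ∩ {x | 0 < ∑ i, x i ∧ ∑ i, x i < 1} := by
    intro R
    ext x
    refine and_congr_right fun hx => ⟨fun h => ⟨?_, h⟩, fun h => h.2⟩
    exact Finset.sum_pos (fun i _ => hx.1 i) Finset.univ_nonempty
  have hsimp : openSimplex (m + 1) = openCone 0 a ∩ {x | ∑ i, x i < 1} := by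
    ext x
    simp [openSimplex, openCone]
  have hv := fun R => volume_cone_eq (measurableSet_openCone R a)
    fun t ht x => smul_mem_openCone ht x
  rw [hsimp, hset, hset, hv, hv, mul_left_comm, mul_left_comm (r : ENNReal),
    ENNReal.mul_right_inj (lintegral_pow_ne_zero m) (lintegral_pow_ne_top m)] at h
  have h := congrArg ENNReal.toReal h
  rw [ENNReal.toReal_mul, ENNReal.toReal_mul, ENNReal.toReal_natCast, ENNReal.toReal_natCast] at h
  have hD' : (D : ℝ) ≠ 0 := by positivity
  rw [measureReal_def, measureReal_def]
  field_simp
  linarith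

theorem tendsto_countCompositions_ratio {m R D r : ℕ} {a : ℕ → Fin (m + 1) → ℤ}
    (ha : ∀ k < R, a k ≠ 0) (hD : 0 < D)
    (h : (D : ENNReal) * volume (openCone R a ∩ {x | ∑ i, x i < 1}) =
      r * volume (openSimplex (m + 1)))
    {F : (Fin (m + 1) → ℕ) → Prop} (K : ℤ)
    (hF : ∀ z, F z → ∀ k < R, 0 ≤ ∑ i, a k i * z i)
    (hF' : ∀ z, (∀ i, K ≤ z i) → (∀ k < R, K ≤ ∑ i, a k i * z i) → F z) :
    Tendsto (fun V : ℕ => (countCompositions (m + 1) F V : ℝ) /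
      countCompositions (m + 1) (fun _ => True) V) atTop (𝓝 (r / D : ℝ)) := by
  have h1 := tendsto_countCompositions_cone ha K hF hF'
  -- With no inequalities the cone is the whole orthant, and the count is that of all profiles.
  have h2 := tendsto_countCompositions_cone (R := 0) (a := a) (by simp) (F := fun _ => True) 0
    (by simp) (by simp)
  have hpos := volume_slice_positive m a
  have h3 := h1.div h2 hpos.ne'
  rw [volume_slice_ratio hD h, mul_div_cancel_right₀ _ hpos.ne'] at h3
  refine h3.congr' ?_
  filter_upwards [eventually_gt_atTop 0] with V hV
  have : (V : ℝ) ^ m ≠ 0 := by positivity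
  exact div_div_div_cancel_right₀ this _ _

end Limits

/-! ### Probabilities as normalized counts -/

section Probability

theorem card_filter_ballotSimplex {n : ℕ} {S : Finset Ballot} {e : Fin n → Ballot}
    (he : Function.Injective e) (hS : ∀ b, b ∈ S ↔ ∃ i, e i = b) (E : Profile → Prop)
    [DecidablePred E] (V : ℕ) :
    ((ballotSimplex S V).filter E).card =
      countCompositions n (fun z => E (Function.extend e z 0)) V := by
  have hsum : ∀ P : Profile, ∑ b ∈ S, P b = ∑ i, P (e i) := by
    intro P
    have : S = Finset.univ.map ⟨e, he⟩ := by
      ext b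
      simp [hS]
    rw [this, Finset.sum_map]
    rfl
  rw [← Set.ncard_coe_finset, countCompositions]
  refine Set.ncard_congr (fun P _ i => P (e i)) ?_ ?_ ?_
  · intro P hP
    simp only [ballotSimplex, Finset.coe_filter, Finset.mem_piAntidiag, Set.mem_ofPred_eq] at hP
    obtain ⟨⟨h1, h2⟩, h3⟩ := hP
    refine ⟨by rw [← hsum, h1], ?_⟩
    have : Function.extend e (fun i => P (e i)) 0 = P := by
      funext b
      by_cases hb : b ∈ S
      · obtain ⟨i, rfl⟩ := (hS b).1 hb
        exact he.extend_apply _ _ _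
      · rw [Function.extend_apply' _ _ _ (fun h => hb ((hS b).2 h))]
        by_contra hne
        exact hb (h2 b (Ne.symm hne))
    rwa [this]
  · intro P Q hP hQ h
    simp only [ballotSimplex, Finset.coe_filter, Finset.mem_piAntidiag, Set.mem_ofPred_eq] at hP hQ
    funext b
    by_cases hb : b ∈ S
    · obtain ⟨i, rfl⟩ := (hS b).1 hb
      exact congrFun h i
    · have h1 : P b = 0 := by_contra fun hne => hb (hP.1.2 b hne)
      have h2 : Q b = 0 := by_contra fun hne => hb (hQ.1.2 b hne)
      rw [h1, h2]
  · rintro z ⟨hz, hE⟩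
    have hz' : (fun i => Function.extend e z 0 (e i)) = z := funext fun i => he.extend_apply _ _ _
    refine ⟨Function.extend e z 0, ?_, hz'⟩
    simp only [ballotSimplex, Finset.coe_filter, Finset.mem_piAntidiag, Set.mem_ofPred_eq]
    refine ⟨⟨?_, fun b hb => ?_⟩, hE⟩
    · rw [hsum]
      simp only [he.extend_apply, hz]
    · by_contra hbS
      exact hb (by rw [Function.extend_apply' _ _ _ (fun h => hbS ((hS b).2 h))]; rfl)

theorem iacProb_eq_countCompositions {n : ℕ} {S : Finset Ballot} {e : Fin n → Ballot}
    (he : Function.Injective e) (hS : ∀ b, b ∈ S ↔ ∃ i, e i = b) (E : Profile → Prop) (V : ℕ) :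
    iacProb S E V = (countCompositions n (fun z => E (Function.extend e z 0)) V : ℝ) /
      countCompositions n (fun _ => True) V := by
  classical
  have h := card_filter_ballotSimplex he hS (fun _ => True) V
  rw [Finset.filter_true] at h
  rw [iacProb, card_filter_ballotSimplex he hS E V, h]

/-- The coefficient of variable `i` in form `k`, in the format of `matrixConeVolume`. -/
def formCoeff {n : ℕ} (ls : List (List ℤ)) (k : ℕ) (i : Fin n) : ℤ := (ls.getD i []).getD k 0

/-- The bridge between voting and geometry: the event must imply the weak inequalities and follow
from inequalities with margin `K`. Ties and strictness therefore never affect the limit. -/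
theorem tendsto_iacProb_of_cone {m R D r : ℕ} {ls : List (List ℤ)} {S : Finset Ballot}
    {e : Fin (m + 1) → Ballot} (he : Function.Injective e) (hS : ∀ b, b ∈ S ↔ ∃ i, e i = b)
    (hn : ls.length = m + 1) (hR : ∀ l ∈ ls, l.length = R)
    (hM : ∀ l ∈ ls, ∀ x ∈ augment l, |x| ≤ 1048576) (hD : 0 < D)
    (ha : ∀ k < R, ∃ i : Fin (m + 1), formCoeff ls k i ≠ 0)
    (hvol : matrixConeVolume D R ls = r + 1) {E : Profile → Prop} (K : ℤ)
    (hE : ∀ P : Profile, (∀ b ∉ S, P b = 0) → E P →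
      ∀ k < R, 0 ≤ ∑ i : Fin (m + 1), formCoeff ls k i * P (e i))
    (hE' : ∀ P : Profile, (∀ b ∉ S, P b = 0) → (∀ b ∈ S, K ≤ P b) →
      (∀ k < R, K ≤ ∑ i : Fin (m + 1), formCoeff ls k i * P (e i)) → E P) :
    Tendsto (iacProb S E) atTop (𝓝 (r / D : ℝ)) := by
  have hset : matrixCone (m + 1) R ls =
      openCone R (formCoeff ls) ∩ {x : Fin (m + 1) → ℝ | ∑ i, x i < 1} := by
    ext x
    simp [matrixCone, openCone, formCoeff, and_assoc]
  have h := volume_matrixCone hn hR hM hvol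
  rw [hset] at h
  have hsupp : ∀ z : Fin (m + 1) → ℕ, ∀ b ∉ S, Function.extend e z 0 b = 0 := fun z b hb =>
    by rw [Function.extend_apply' _ _ _ (fun h => hb ((hS b).2 h))]; rfl
  have h1 := tendsto_countCompositions_ratio (fun k hk h0 => by
      obtain ⟨i, hi⟩ := ha k hk
      exact hi (congrFun h0 i)) hD h
    (F := fun z => E (Function.extend e z 0)) K (fun z hz k hk => by
      have := hE _ (hsupp z) hz k hk
      simpa only [he.extend_apply] using this) (fun z hz hz' => by
      refine hE' _ (hsupp z) (fun b hb => ?_) fun k hk => ?_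
      · obtain ⟨i, rfl⟩ := (hS b).1 hb
        rw [he.extend_apply]
        exact hz i
      · simpa only [he.extend_apply] using hz' k hk)
  exact h1.congr fun V => (iacProb_eq_countCompositions he hS E V).symm

theorem iacProb_congr {S : Finset Ballot} {E F : Profile → Prop} (h : ∀ P, E P ↔ F P) :
    iacProb S E = iacProb S F := by
  rw [show E = F from funext fun P => propext (h P)]

theorem iacProb_exists {ι : Type*} [Fintype ι] {S : Finset Ballot} {F : ι → Profile → Prop}
    (hF : ∀ P i j, F i P → F j P → i = j) (V : ℕ) :
    iacProb S (fun P => ∃ i, F i P) V = ∑ i, iacProb S (F i) V := by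
  classical
  simp only [iacProb]
  rw [← Finset.sum_div, ← Nat.cast_sum, ← Finset.card_biUnion]
  · congr 3
    ext P
    simp
  · intro i _ j _ hij
    rw [Function.onFun, Finset.disjoint_left]
    intro P hi hj
    exact hij (hF P i j (Finset.mem_filter.1 hi).2 (Finset.mem_filter.1 hj).2)

theorem iacProb_or (S : Finset Ballot) (E F : Profile → Prop) (V : ℕ) :
    iacProb S (fun P => E P ∨ F P) V =
      iacProb S E V + iacProb S F V - iacProb S (fun P => E P ∧ F P) V := by
  classical
  simp only [iacProb]
  rw [← add_div, ← sub_div]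
  congr 1
  have h := Finset.card_union_add_card_inter ((ballotSimplex S V).filter E)
    ((ballotSimplex S V).filter F)
  rw [← Finset.filter_or, ← Finset.filter_and] at h
  rw [eq_sub_iff_add_eq]
  norm_cast
  convert! h

end Probability

/-! ### Reinforcement paradoxes as linear inequalities -/

section Voting

/-- The ballot that ranks `x` first and `y` second, or `x` alone if `x = y`. -/
def ballot (x y : Candidate) : Ballot :=
  if h : x = y then ⟨(x, none), by simp⟩
  else ⟨(x, some y), fun h' => h (Option.some.inj h').symm⟩

theorem exists_ballot_eq : ∀ b : Ballot, ∃ x y, b = ballot x y := by decide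

theorem firstVotes_eq {A B C : Candidate} (hAB : A ≠ B) (hAC : A ≠ C) (hBC : B ≠ C) (P : Profile) :
    firstVotes P A = P (ballot A A) + P (ballot A B) + P (ballot A C) := by
  have h : ∀ A B C : Candidate, A ≠ B → A ≠ C → B ≠ C →
      (Finset.univ.filter fun b : Ballot => firstChoice b = A) =
        {ballot A A, ballot A B, ballot A C} ∧ ballot A A ∉ ({ballot A B, ballot A C} : Finset _) ∧
        ballot A B ∉ ({ballot A C} : Finset _) := by decide
  obtain ⟨h1, h2, h3⟩ := h A B C hAB hAC hBC
  rw [firstVotes, h1, Finset.sum_insert h2, Finset.sum_insert h3, Finset.sum_singleton, add_assoc]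

theorem secondRoundVotes_eq {D A : Candidate} (h : A ≠ D) (P : Profile) :
    secondRoundVotes P D A = firstVotes P A + P (ballot D A) := by
  have h : ∀ A D : Candidate, A ≠ D →
      (Finset.univ.filter fun b : Ballot =>
        firstChoice b = A ∨ (firstChoice b = D ∧ secondChoice b = some A)) =
      insert (ballot D A) (Finset.univ.filter fun b : Ballot => firstChoice b = A) ∧
      ballot D A ∉ Finset.univ.filter fun b : Ballot => firstChoice b = A := by decide
  obtain ⟨h1, h2⟩ := h A D ‹_›
  rw [secondRoundVotes, h1, Finset.sum_insert h2, firstVotes, add_comm]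

theorem eq_of_distinct {A B C : Candidate} (hAB : A ≠ B) (hAC : A ≠ C) (hBC : B ≠ C)
    (x : Candidate) : x = A ∨ x = B ∨ x = C := by
  revert A B C x
  decide

theorem numVoters_eq {A B C : Candidate} (hAB : A ≠ B) (hAC : A ≠ C) (hBC : B ≠ C) (P : Profile) :
    numVoters P = firstVotes P A + firstVotes P B + firstVotes P C := by
  have hu : (Finset.univ : Finset Candidate) = {A, B, C} := by
    revert A B C
    decide
  rw [numVoters, ← Finset.sum_fiberwise_of_maps_to (s := Finset.univ) (t := Finset.univ)
    (g := firstChoice) (fun _ _ => Finset.mem_univ _), hu, Finset.sum_insert (by simp [hAB, hAC]),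
    Finset.sum_insert (by simp [hBC]), Finset.sum_singleton, add_assoc]
  rfl

/-- `D` trails both others, and a majority for `E` would contradict `h3`, as `D` passes on at most
all its votes. So either `A` has a majority or `D` is the only possible elimination. -/
theorem isIRVWinner_of_lt {A D E : Candidate} (hAD : A ≠ D) (hAE : A ≠ E) (hDE : D ≠ E)
    {P : Profile} (h1 : firstVotes P D < firstVotes P A) (h2 : firstVotes P D < firstVotes P E)
    (h3 : firstVotes P E + P (ballot D E) < firstVotes P A + P (ballot D A)) :
    IsIRVWinner P A := by
  have hn := numVoters_eq hAD hAE hDE P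
  have hD := firstVotes_eq hAD.symm hDE hAE P
  by_cases hmaj : IsMajorityCandidate P A
  · exact Or.inl hmaj
  refine Or.inr ⟨fun c => ?_, fun d hd => ?_⟩
  · rcases eq_of_distinct hAD hAE hDE c with rfl | rfl | rfl
    · exact hmaj
    · unfold IsMajorityCandidate
      omega
    · unfold IsMajorityCandidate
      omega
  · have hdD : d = D := by
      rcases eq_of_distinct hAD hAE hDE d with rfl | rfl | rfl
      · exact absurd (hd D) (by omega)
      · rfl
      · exact absurd (hd D) (by omega)
    subst hdD
    refine ⟨hAD, fun e heA hed => ?_⟩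
    have heE : e = E := by
      rcases eq_of_distinct hAD hAE hDE e with rfl | rfl | rfl
      · exact absurd rfl heA
      · exact absurd rfl hed
      · rfl
    subst heE
    rw [secondRoundVotes_eq hed, secondRoundVotes_eq hAD]
    exact h3

theorem exists_hasFewestFirstVotes (P : Profile) : ∃ d, HasFewestFirstVotes P d := by
  obtain ⟨d, -, hd⟩ := Finset.exists_min_image Finset.univ (firstVotes P) ⟨0, Finset.mem_univ 0⟩
  exact ⟨d, fun e => hd e (Finset.mem_univ e)⟩

/-- A majority winner outvotes both rivals together, hence also beats the stronger after elimination
of the weaker. This removes the majority case from all later arguments. -/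
theorem IsIRVWinner.exists_elimination {A B C : Candidate} (hAB : A ≠ B) (hAC : A ≠ C)
    (hBC : B ≠ C) {P : Profile} (h : IsIRVWinner P A) :
    (firstVotes P B ≤ firstVotes P A ∧ firstVotes P B ≤ firstVotes P C ∧
      firstVotes P C + P (ballot B C) < firstVotes P A + P (ballot B A)) ∨
    (firstVotes P C ≤ firstVotes P A ∧ firstVotes P C ≤ firstVotes P B ∧
      firstVotes P B + P (ballot C B) < firstVotes P A + P (ballot C A)) := by
  have hB := firstVotes_eq hAB.symm hBC hAC P
  have hC := firstVotes_eq hAC.symm hBC.symm hAB P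
  have hn := numVoters_eq hAB hAC hBC P
  rcases h with h | ⟨-, h⟩
  · unfold IsMajorityCandidate at h
    omega
  · obtain ⟨d, hd⟩ := exists_hasFewestFirstVotes P
    obtain ⟨hAd, h⟩ := h d hd
    rcases eq_of_distinct hAB hAC hBC d with rfl | rfl | rfl
    · exact absurd rfl hAd
    · have h := h C hAC.symm hBC.symm
      rw [secondRoundVotes_eq hBC.symm, secondRoundVotes_eq hAB] at h
      exact Or.inl ⟨hd A, hd C, h⟩
    · have h := h B hAB.symm hBC
      rw [secondRoundVotes_eq hBC, secondRoundVotes_eq hAC] at h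
      exact Or.inr ⟨hd A, hd B, h⟩

theorem IsIRVWinner.unique {P : Profile} {A B : Candidate} (hA : IsIRVWinner P A)
    (hB : IsIRVWinner P B) : A = B := by
  by_contra hAB
  have hthird : ∀ A B : Candidate, ∃ C, A ≠ C ∧ B ≠ C := by decide
  obtain ⟨C, hAC, hBC⟩ := hthird A B
  have hn := numVoters_eq hAB hAC hBC P
  rcases hA with hA | ⟨hA0, hA⟩ <;> rcases hB with hB | ⟨hB0, hB⟩
  · unfold IsMajorityCandidate at hA hB
    omega
  · exact hB0 _ hA
  · exact hA0 _ hB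
  · obtain ⟨d, hd⟩ := exists_hasFewestFirstVotes P
    have h1 := (hA d hd).2 B (Ne.symm hAB) (hB d hd).1
    have h2 := (hB d hd).2 A hAB (hA d hd).1
    omega

theorem IsPluralityLoser.unique {P : Profile} {A B : Candidate} (hA : IsPluralityLoser P A)
    (hB : IsPluralityLoser P B) : A = B := by
  by_contra hAB
  have h1 := hA B (Ne.symm hAB)
  have h2 := hB A hAB
  omega

/-- The profile with `g x y` ballots of type `ballot x y`. -/
def profileOf (g : Candidate → Candidate → ℕ) : Profile :=
  fun b => g (firstChoice b) ((secondChoice b).getD (firstChoice b))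

theorem profileOf_ballot (g : Candidate → Candidate → ℕ) (x y : Candidate) :
    profileOf g (ballot x y) = g x y := by
  by_cases h : x = y
  · subst h
    simp [profileOf, ballot, firstChoice, secondChoice]
  · simp [profileOf, ballot, firstChoice, secondChoice, h]

/-- Either the winner of both parts of a split wins after different eliminations, or it wins the
whole election. -/
theorem WinsBothPartsOfSplit.inequalities {A B C : Candidate} (hAB : A ≠ B) (hAC : A ≠ C)
    (hBC : B ≠ C) {P : Profile} (h : WinsBothPartsOfSplit P A) :
    (firstVotes P C ≤ firstVotes P A + P (ballot B A) ∧
      firstVotes P B ≤ firstVotes P A + P (ballot C A) ∧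
      firstVotes P B + firstVotes P C ≤ 3 * firstVotes P A ∧
      P (ballot B C) + P (ballot C B) ≤ firstVotes P A + P (ballot B A) + P (ballot C A)) ∨
    (firstVotes P B ≤ firstVotes P A ∧ firstVotes P B ≤ firstVotes P C) ∧
      firstVotes P C + P (ballot B C) < firstVotes P A + P (ballot B A) ∨
    (firstVotes P C ≤ firstVotes P A ∧ firstVotes P C ≤ firstVotes P B) ∧
      firstVotes P B + P (ballot C B) < firstVotes P A + P (ballot C A) := by
  obtain ⟨Q, R, rfl, hQ, hR⟩ := h
  have hQ := hQ.exists_elimination hAB hAC hBC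
  have hR := hR.exists_elimination hAB hAC hBC
  have q1 := firstVotes_eq hAB hAC hBC Q
  have q2 := firstVotes_eq hAB.symm hBC hAC Q
  have q3 := firstVotes_eq hAC.symm hBC.symm hAB Q
  have r1 := firstVotes_eq hAB hAC hBC R
  have r2 := firstVotes_eq hAB.symm hBC hAC R
  have r3 := firstVotes_eq hAC.symm hBC.symm hAB R
  have s1 := firstVotes_eq hAB hAC hBC (Q + R)
  have s2 := firstVotes_eq hAB.symm hBC hAC (Q + R)
  have s3 := firstVotes_eq hAC.symm hBC.symm hAB (Q + R)
  simp only [Pi.add_apply] at s1 s2 s3 ⊢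
  -- Equal eliminations add up to the same elimination for the whole election; different ones give
  -- the first alternative.
  rcases hQ with hQ | hQ <;> rcases hR with hR | hR
  · right; left; omega
  · left; omega
  · left; omega
  · right; right; omega

/-- The first part takes `u` votes of `A`, `p + q` of `B`, no ballot B > C, and all votes of `C`
except `r + t`. There `B` is eliminated and `C` gains nothing (`h1`–`h3`); in the rest `C` is
eliminated and `B` gains nothing (`h4`–`h6`). -/
theorem winsBothPartsOfSplit_of_split {A B C : Candidate} (hAB : A ≠ B) (hAC : A ≠ C)
    (hBC : B ≠ C) {P : Profile} {p q r t u : ℕ} (hp : p ≤ P (ballot B A)) (hq : q ≤ P (ballot B B))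
    (hr : r ≤ P (ballot C A)) (ht : t ≤ P (ballot C C)) (hu : u ≤ firstVotes P A)
    (h1 : p + q < u) (h2 : p + q + (r + t) < firstVotes P C)
    (h3 : firstVotes P C < u + p + (r + t))
    (h4 : r + t + u < firstVotes P A) (h5 : p + q + (r + t) < firstVotes P B)
    (h6 : firstVotes P B + u < firstVotes P A + r + (p + q)) :
    WinsBothPartsOfSplit P A := by
  have s1 := firstVotes_eq hAB hAC hBC P
  have s2 := firstVotes_eq hAB.symm hBC hAC P
  have s3 := firstVotes_eq hAC.symm hBC.symm hAB P
  -- Only the number of votes for `A` matters, so the `u` votes are drawn greedily from its three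
  -- ballot types.
  obtain ⟨x, y, z, hx, hy, hz, hxyz⟩ : ∃ x y z, x ≤ P (ballot A A) ∧ y ≤ P (ballot A B) ∧
      z ≤ P (ballot A C) ∧ x + y + z = u :=
    ⟨min u (P (ballot A A)), min (u - P (ballot A A)) (P (ballot A B)),
      u - P (ballot A A) - P (ballot A B), by omega, by omega, by omega, by omega⟩
  let g : Candidate → Candidate → ℕ := fun v w =>
    if v = A then (if w = A then x else if w = B then y else z)
    else if v = B then (if w = A then p else if w = B then q else 0)
    else (if w = A then P (ballot C A) - r else if w = C then P (ballot C C) - t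
      else P (ballot C B))
  have hAA : profileOf g (ballot A A) = x := by simp [profileOf_ballot, g]
  have hAB' : profileOf g (ballot A B) = y := by simp [profileOf_ballot, g, hAB.symm]
  have hAC' : profileOf g (ballot A C) = z := by simp [profileOf_ballot, g, hAC.symm, hBC.symm]
  have hBA : profileOf g (ballot B A) = p := by simp [profileOf_ballot, g, hAB.symm]
  have hBB : profileOf g (ballot B B) = q := by simp [profileOf_ballot, g, hAB.symm]
  have hBC' : profileOf g (ballot B C) = 0 := by
    simp [profileOf_ballot, g, hAB.symm, hAC.symm, hBC.symm]
  have hCA : profileOf g (ballot C A) = P (ballot C A) - r := by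
    simp [profileOf_ballot, g, hAC.symm, hBC.symm]
  have hCB : profileOf g (ballot C B) = P (ballot C B) := by
    simp [profileOf_ballot, g, hAC.symm, hBC.symm, hAB.symm, hBC]
  have hCC : profileOf g (ballot C C) = P (ballot C C) - t := by
    simp [profileOf_ballot, g, hAC.symm, hBC.symm]
  set Q := profileOf g
  have hQP : ∀ b, Q b ≤ P b := by
    intro b
    obtain ⟨v, w, rfl⟩ := exists_ballot_eq b
    rcases eq_of_distinct hAB hAC hBC v with rfl | rfl | rfl <;>
      rcases eq_of_distinct hAB hAC hBC w with rfl | rfl | rfl <;> omega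
  have e1 := firstVotes_eq hAB hAC hBC Q
  have e2 := firstVotes_eq hAB.symm hBC hAC Q
  have e3 := firstVotes_eq hAC.symm hBC.symm hAB Q
  have f1 := firstVotes_eq hAB hAC hBC fun b => P b - Q b
  have f2 := firstVotes_eq hAB.symm hBC hAC fun b => P b - Q b
  have f3 := firstVotes_eq hAC.symm hBC.symm hAB fun b => P b - Q b
  refine ⟨Q, fun b => P b - Q b, ?_, ?_, ?_⟩
  · funext b
    exact Nat.add_sub_cancel' (hQP b)
  · exact isIRVWinner_of_lt hAB hAC hBC (by omega) (by omega) (by omega)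
  · exact isIRVWinner_of_lt hAC hAB hBC.symm (by omega) (by omega) (by omega)

/-- A candidate who clears the given inequalities by a margin wins both parts of a split. -/
theorem winsBothPartsOfSplit_of_le {A B C : Candidate} (hAB : A ≠ B) (hAC : A ≠ C)
    (hBC : B ≠ C) {P : Profile}
    (hA : 10 ≤ firstVotes P A) (hB : 10 ≤ firstVotes P B) (hC : 10 ≤ firstVotes P C)
    (h1 : firstVotes P C + 10 ≤ firstVotes P A + P (ballot B A))
    (h2 : firstVotes P B + 10 ≤ firstVotes P A + P (ballot C A))
    (h3 : firstVotes P B + firstVotes P C + 10 ≤ 3 * firstVotes P A)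
    (h4 : firstVotes P C + 10 ≤ firstVotes P A + firstVotes P B)
    (h5 : firstVotes P B + 10 ≤ firstVotes P A + firstVotes P C)
    (h6 : P (ballot B C) + P (ballot C B) + 10 ≤
      firstVotes P A + P (ballot B A) + P (ballot C A)) :
    WinsBothPartsOfSplit P A := by
  have s1 := firstVotes_eq hAB hAC hBC P
  have s2 := firstVotes_eq hAB.symm hBC hAC P
  have s3 := firstVotes_eq hAC.symm hBC.symm hAB P
  generalize ha : firstVotes P A = a at *
  generalize hb : firstVotes P B = b at *
  generalize hc : firstVotes P C = c at *
  -- The candidates eliminated in the two parts keep p + q + r + t first places in total, which must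
  -- stay below each of `a`, `b`, `c`; `m - 2` leaves room for strictness.
  obtain ⟨m, hma, hmb, hmc, hm⟩ : ∃ m, m ≤ a ∧ m ≤ b ∧ m ≤ c ∧ (m = a ∨ m = b ∨ m = c) := by
    rcases le_total a b with h | h <;> rcases le_total b c with h' | h' <;>
      rcases le_total a c with h'' | h''
    all_goals first
      | exact ⟨a, by omega, by omega, by omega, by omega⟩
      | exact ⟨b, by omega, by omega, by omega, by omega⟩
      | exact ⟨c, by omega, by omega, by omega, by omega⟩
  -- Ballots passing to `A` count twice in `key`, so they are used first. The witness for `p`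
  -- reserves `b + 2 - a` places for `r`.
  obtain ⟨p, r, hp, hr, hp', hr', hpr⟩ : ∃ p r, p ≤ P (ballot B A) ∧ r ≤ P (ballot C A) ∧
      c + 2 ≤ a + p ∧ b + 2 ≤ a + r ∧
      (p + r = m - 2 ∨ p + r ≤ m - 2 ∧ p = P (ballot B A) ∧ r = P (ballot C A)) := by
    by_cases h : P (ballot B A) + P (ballot C A) ≤ m - 2
    · exact ⟨P (ballot B A), P (ballot C A), le_rfl, le_rfl, by omega, by omega, Or.inr (by omega)⟩
    · exact ⟨min (P (ballot B A)) (m - 2 - (b + 2 - a)),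
        m - 2 - min (P (ballot B A)) (m - 2 - (b + 2 - a)), by omega, by omega, by omega, by omega,
        by omega⟩
  obtain ⟨q, t, hq, ht, hqt⟩ : ∃ q t, q ≤ P (ballot B B) ∧ t ≤ P (ballot C C) ∧
      (p + r + (q + t) = m - 2 ∨ p + r + (q + t) ≤ m - 2 ∧ q = P (ballot B B) ∧
        t = P (ballot C C)) := by
    by_cases h : P (ballot B B) + P (ballot C C) ≤ m - 2 - (p + r)
    · exact ⟨P (ballot B B), P (ballot C C), le_rfl, le_rfl, Or.inr (by omega)⟩
    · exact ⟨min (P (ballot B B)) (m - 2 - (p + r)),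
        m - 2 - (p + r) - min (P (ballot B B)) (m - 2 - (p + r)), by omega, by omega, by omega⟩
  -- This leaves room for `u` between its bounds in `h3` and `h6`. If p + r = m - 2 it comes from
  -- `h3`, `h4` or `h5`, according to which total is `m`; if q and t only fill up the rest, from
  -- `h1` and `h2`; if all four are exhausted, from `h6`.
  have key : b + c + 2 ≤ a + 2 * (p + r) + (q + t) := by omega
  -- `u` is the least value allowed by the first part; the other part needs it small.
  refine winsBothPartsOfSplit_of_split hAB hAC hBC (u := max (p + q) (c - (r + t) - p) + 1)
    hp hq hr ht ?_ ?_ ?_ ?_ ?_ ?_ ?_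
  all_goals omega

theorem IsPluralityLoser.inequalities {A B C : Candidate} (hAB : A ≠ B) (hAC : A ≠ C) (hBC : B ≠ C)
    {P : Profile} (hA : IsPluralityLoser P A) (h : WinsBothPartsOfSplit P A) :
    (firstVotes P A < firstVotes P B ∧ firstVotes P A < firstVotes P C) ∧
      firstVotes P C ≤ firstVotes P A + P (ballot B A) ∧
      firstVotes P B ≤ firstVotes P A + P (ballot C A) ∧
      firstVotes P B + firstVotes P C ≤ 3 * firstVotes P A ∧
      P (ballot B C) + P (ballot C B) ≤ firstVotes P A + P (ballot B A) + P (ballot C A) := by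
  have h1 := hA B hAB.symm
  have h2 := hA C hAC.symm
  have h := h.inequalities hAB hAC hBC
  omega

/-- The two omitted split conditions are automatic: C has fewer first places than A, and B has at
most a + c < 2a. -/
theorem IsIRVWinner.inequalities {A B C : Candidate} (hAB : A ≠ B) (hAC : A ≠ C) (hBC : B ≠ C)
    {P : Profile} (hB : IsIRVWinner P B) (hC : IsPluralityLoser P C)
    (h : WinsBothPartsOfSplit P A) :
    (firstVotes P C < firstVotes P A ∧ firstVotes P C < firstVotes P B) ∧
      firstVotes P A + P (ballot C A) < firstVotes P B + P (ballot C B) ∧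
      firstVotes P B ≤ firstVotes P A + P (ballot C A) ∧
      P (ballot B C) + P (ballot C B) ≤ firstVotes P A + P (ballot B A) + P (ballot C A) := by
  have h1 := hC A hAC
  have h2 := hC B hBC
  have h3 := hB.exists_elimination hAB.symm hBC hAC
  have h := h.inequalities hAB hAC hBC
  omega

theorem isPluralityLoser_of_lt {A B C : Candidate} (hAB : A ≠ B) (hAC : A ≠ C) (hBC : B ≠ C)
    {P : Profile} (h1 : firstVotes P A < firstVotes P B) (h2 : firstVotes P A < firstVotes P C) :
    IsPluralityLoser P A := by
  intro d hd
  rcases eq_of_distinct hAB hAC hBC d with rfl | rfl | rfl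
  · exact absurd rfl hd
  · exact h1
  · exact h2

theorem noMajorityCandidate_iff {A B C : Candidate} (hAB : A ≠ B) (hAC : A ≠ C) (hBC : B ≠ C)
    {P : Profile} : NoMajorityCandidate P ↔ firstVotes P A ≤ firstVotes P B + firstVotes P C ∧
      firstVotes P B ≤ firstVotes P A + firstVotes P C ∧
      firstVotes P C ≤ firstVotes P A + firstVotes P B := by
  have hn := numVoters_eq hAB hAC hBC P
  unfold NoMajorityCandidate IsMajorityCandidate
  constructor
  · intro h
    have h1 := h A
    have h2 := h B
    have h3 := h C
    omega
  · rintro h d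
    rcases eq_of_distinct hAB hAC hBC d with rfl | rfl | rfl <;> omega

/-- The event that `σ 0` is the runner-up and wins both parts of a split, while `σ 1` is the winner
and `σ 2` the plurality loser. -/
def RUParadoxFor (σ : Equiv.Perm Candidate) (P : Profile) : Prop :=
  IsIRVWinner P (σ 1) ∧ IsPluralityLoser P (σ 2) ∧ WinsBothPartsOfSplit P (σ 0)

theorem RUParadoxFor.unique {σ τ : Equiv.Perm Candidate} {P : Profile} (h : RUParadoxFor σ P)
    (h' : RUParadoxFor τ P) : σ = τ := by
  have key : ∀ σ τ : Equiv.Perm Candidate, σ 1 = τ 1 → σ 2 = τ 2 → σ = τ := by decide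
  exact key σ τ (h.1.unique h'.1) (h.2.1.unique h'.2.1)

theorem RUParadox_iff (P : Profile) : RUParadox P ↔ ∃ σ, RUParadoxFor σ P := by
  constructor
  · rintro ⟨c, ⟨w, l, hw, hl, hcw, hcl⟩, h⟩
    -- A winner has at least as many first places as some eliminated rival, so it is not the strict
    -- plurality loser.
    have hwl : w ≠ l := by
      rintro rfl
      obtain ⟨e, he⟩ : ∃ e : Candidate, w ≠ e ∧ c ≠ e := by
        have hthird : ∀ A B : Candidate, ∃ C, A ≠ C ∧ B ≠ C := by decide
        exact hthird w c
      have h2 := hw.exists_elimination hcw.symm he.1 he.2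
      have h3 := hl c hcw
      have h4 := hl e he.1.symm
      omega
    have key : ∀ c w l : Candidate, c ≠ w → c ≠ l → w ≠ l →
        ∃ σ : Equiv.Perm Candidate, σ 0 = c ∧ σ 1 = w ∧ σ 2 = l := by decide
    obtain ⟨σ, rfl, rfl, rfl⟩ := key c w l hcw hcl hwl
    exact ⟨σ, hw, hl, h⟩
  · rintro ⟨σ, hw, hl, h⟩
    exact ⟨σ 0, ⟨σ 1, σ 2, hw, hl, by simp, by simp⟩, h⟩

theorem DoubleParadox_iff (P : Profile) :
    DoubleParadox P ↔ ∃ σ, RUParadoxFor σ P ∧ WinsBothPartsOfSplit P (σ 2) := by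
  rw [DoubleParadox, RUParadox_iff]
  constructor
  · rintro ⟨⟨c, hc, h⟩, σ, hσ⟩
    have := hc.unique hσ.2.1
    subst this
    exact ⟨σ, hσ, h⟩
  · rintro ⟨σ, hσ, h⟩
    exact ⟨⟨σ 2, hσ.2.1, h⟩, σ, hσ⟩

theorem EitherParadox.noMajorityCandidate {P : Profile} (h : EitherParadox P) :
    NoMajorityCandidate P := by
  have hthird : ∀ A : Candidate, ∃ B C, A ≠ B ∧ A ≠ C ∧ B ≠ C := by decide
  rcases h with ⟨c, hc, h⟩ | h
  · obtain ⟨B, C, hAB, hAC, hBC⟩ := hthird c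
    have h := hc.inequalities hAB hAC hBC h
    rw [noMajorityCandidate_iff hAB hAC hBC]
    omega
  · obtain ⟨σ, hw, hl, h⟩ := (RUParadox_iff P).1 h
    have hAB : σ 0 ≠ σ 1 := by simp
    have hAC : σ 0 ≠ σ 2 := by simp
    have hBC : σ 1 ≠ σ 2 := by simp
    have h := hw.inequalities hAB hAC hBC hl h
    have s1 := firstVotes_eq hAC.symm hBC.symm hAB P
    rw [noMajorityCandidate_iff hAB hAC hBC]
    omega

end Voting

/-! ### The matrices of the cones -/

section Orders

/-- The order of the ballots in `pluralityLoserCompleteForms`. -/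
def pluralityLoserCompleteOrder (A B C : Candidate) : Fin 6 → Ballot :=
  ![ballot C A, ballot B C, ballot A C, ballot B A, ballot C B, ballot A B]

theorem pluralityLoserCompleteOrder_spec : ∀ A B C : Candidate, A ≠ B → A ≠ C → B ≠ C →
    Function.Injective (pluralityLoserCompleteOrder A B C) ∧
      ∀ b, b ∈ completeBallots ↔ ∃ i, pluralityLoserCompleteOrder A B C i = b := by
  decide +kernel

/-- The coefficients of the linear forms, variable by variable, for the event
that a candidate is the plurality loser and wins both parts of a split. -/
def pluralityLoserCompleteForms : List (List ℤ) :=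
  [[1, 0, -1, 1, 1, -1], [-1, 1, 0, 0, -1, -1], [1, -1, 1, -1, 1, 3], [1, 1, 1, 0, -1, -1],
   [-1, 0, -1, 1, 0, -1], [1, -1, 1, -1, 1, 3]]

/-- The order of the ballots in `pluralityLoserPartialForms`. -/
def pluralityLoserPartialOrder (A B C : Candidate) : Fin 9 → Ballot :=
  ![ballot B B, ballot C C, ballot C A, ballot B C, ballot A A, ballot A C, ballot B A,
      ballot C B, ballot A B]

theorem pluralityLoserPartialOrder_spec : ∀ A B C : Candidate, A ≠ B → A ≠ C → B ≠ C →
    Function.Injective (pluralityLoserPartialOrder A B C) ∧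
      ∀ b, b ∈ partialBallots ↔ ∃ i, pluralityLoserPartialOrder A B C i = b := by
  decide +kernel

/-- The coefficients of the linear forms, variable by variable, for the event
that a candidate is the plurality loser and wins both parts of a split. -/
def pluralityLoserPartialForms : List (List ℤ) :=
  [[0, 1, 0, 0, -1, -1], [0, 0, -1, 1, 0, -1], [1, 0, -1, 1, 1, -1], [-1, 1, 0, 0, -1, -1],
   [1, -1, 1, -1, 1, 3], [1, -1, 1, -1, 1, 3], [1, 1, 1, 0, -1, -1], [-1, 0, -1, 1, 0, -1],
   [1, -1, 1, -1, 1, 3]]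

/-- The order of the ballots in `runnerUpCompleteForms`. -/
def runnerUpCompleteOrder (A B C : Candidate) : Fin 6 → Ballot :=
  ![ballot C A, ballot B C, ballot C B, ballot A C, ballot A B, ballot B A]

theorem runnerUpCompleteOrder_spec : ∀ A B C : Candidate, A ≠ B → A ≠ C → B ≠ C →
    Function.Injective (runnerUpCompleteOrder A B C) ∧
      ∀ b, b ∈ completeBallots ↔ ∃ i, runnerUpCompleteOrder A B C i = b := by
  decide +kernel

/-- The coefficients of the linear forms, variable by variable, for the event
that a given runner-up, for a given winner, wins both parts of a split. -/
def runnerUpCompleteForms : List (List ℤ) :=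
  [[-1, -1, -1, 1, 1], [1, 0, 1, -1, -1], [1, -1, -1, -1, 0], [-1, 1, 0, 1, 1], [-1, 1, 0, 1, 1],
   [1, 0, 1, 1, -1]]

/-- The order of the ballots in `runnerUpPartialForms`. -/
def runnerUpPartialOrder (A B C : Candidate) : Fin 9 → Ballot :=
  ![ballot C A, ballot B C, ballot C B, ballot A C, ballot C C, ballot A B, ballot A A,
      ballot B B, ballot B A]

theorem runnerUpPartialOrder_spec : ∀ A B C : Candidate, A ≠ B → A ≠ C → B ≠ C →
    Function.Injective (runnerUpPartialOrder A B C) ∧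
      ∀ b, b ∈ partialBallots ↔ ∃ i, runnerUpPartialOrder A B C i = b := by
  decide +kernel

/-- The coefficients of the linear forms, variable by variable, for the event
that a given runner-up, for a given winner, wins both parts of a split. -/
def runnerUpPartialForms : List (List ℤ) :=
  [[-1, -1, -1, 1, 1], [1, 0, 1, -1, -1], [1, -1, -1, -1, 0], [-1, 1, 0, 1, 1], [0, -1, -1, 0, 0],
   [-1, 1, 0, 1, 1], [-1, 1, 0, 1, 1], [1, 0, 1, 0, -1], [1, 0, 1, 1, -1]]

/-- The order of the ballots in `doubleCompleteForms`. -/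
def doubleCompleteOrder (A B C : Candidate) : Fin 6 → Ballot :=
  ![ballot B C, ballot C B, ballot A B, ballot B A, ballot A C, ballot C A]

theorem doubleCompleteOrder_spec : ∀ A B C : Candidate, A ≠ B → A ≠ C → B ≠ C →
    Function.Injective (doubleCompleteOrder A B C) ∧
      ∀ b, b ∈ completeBallots ↔ ∃ i, doubleCompleteOrder A B C i = b := by
  decide +kernel

/-- The coefficients of the linear forms, variable by variable, for the event
that both a given runner-up and a given plurality loser win both parts of a split. -/
def doubleCompleteForms : List (List ℤ) :=
  [[1, 1, 0, -1, -1, -1, 1, -1, 1], [1, 1, -1, 1, -1, 3, -1, 0, 1],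
   [-1, -1, 1, 0, 1, -1, 0, 1, -1], [-1, 1, 0, -1, 1, -1, 1, -1, 0],
   [1, -1, 1, 1, 1, -1, 0, 1, -1], [1, -1, -1, 1, 1, 3, -1, 1, 1]]

/-- The order of the ballots in `doublePartialForms`. -/
def doublePartialOrder (A B C : Candidate) : Fin 9 → Ballot :=
  ![ballot A A, ballot B B, ballot C C, ballot B C, ballot C B, ballot A B, ballot B A,
      ballot A C, ballot C A]

theorem doublePartialOrder_spec : ∀ A B C : Candidate, A ≠ B → A ≠ C → B ≠ C →
    Function.Injective (doublePartialOrder A B C) ∧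
      ∀ b, b ∈ partialBallots ↔ ∃ i, doublePartialOrder A B C i = b := by
  decide +kernel

/-- The coefficients of the linear forms, variable by variable, for the event
that both a given runner-up and a given plurality loser win both parts of a split. -/
def doublePartialForms : List (List ℤ) :=
  [[0, -1, 1, 0, 1, -1, 0, 1, -1], [0, 1, 0, -1, 0, -1, 1, -1, 0], [1, 0, -1, 1, 0, 3, -1, 0, 1],
   [1, 1, 0, -1, -1, -1, 1, -1, 1], [1, 1, -1, 1, -1, 3, -1, 0, 1],
   [-1, -1, 1, 0, 1, -1, 0, 1, -1], [-1, 1, 0, -1, 1, -1, 1, -1, 0],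
   [1, -1, 1, 1, 1, -1, 0, 1, -1], [1, -1, -1, 1, 1, 3, -1, 1, 1]]

/-- The order of the ballots in `noMajorityCompleteForms`. -/
def noMajorityCompleteOrder (A B C : Candidate) : Fin 6 → Ballot :=
  ![ballot A B, ballot A C, ballot B A, ballot B C, ballot C A, ballot C B]

theorem noMajorityCompleteOrder_spec : ∀ A B C : Candidate, A ≠ B → A ≠ C → B ≠ C →
    Function.Injective (noMajorityCompleteOrder A B C) ∧
      ∀ b, b ∈ completeBallots ↔ ∃ i, noMajorityCompleteOrder A B C i = b := by
  decide +kernel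

/-- The coefficients of the linear forms, variable by variable, for the absence of a
majority candidate. -/
def noMajorityCompleteForms : List (List ℤ) :=
  [[-1, 1, 1], [-1, 1, 1], [1, -1, 1], [1, -1, 1], [1, 1, -1], [1, 1, -1]]

/-- The order of the ballots in `noMajorityPartialForms`. -/
def noMajorityPartialOrder (A B C : Candidate) : Fin 9 → Ballot :=
  ![ballot A B, ballot A C, ballot B A, ballot B C, ballot C A, ballot C B, ballot A A,
      ballot B B, ballot C C]

theorem noMajorityPartialOrder_spec : ∀ A B C : Candidate, A ≠ B → A ≠ C → B ≠ C →
    Function.Injective (noMajorityPartialOrder A B C) ∧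
      ∀ b, b ∈ partialBallots ↔ ∃ i, noMajorityPartialOrder A B C i = b := by
  decide +kernel

/-- The coefficients of the linear forms, variable by variable, for the absence of a
majority candidate. -/
def noMajorityPartialForms : List (List ℤ) :=
  [[-1, 1, 1], [-1, 1, 1], [1, -1, 1], [1, -1, 1], [1, 1, -1], [1, 1, -1], [-1, 1, 1], [1, -1, 1],
   [1, 1, -1]]

end Orders

/-! ### The eight volume computations -/

section Volumes

set_option maxRecDepth 100000 in
theorem matrixConeVolume_pluralityLoserCompleteForms :
    matrixConeVolume 132710400 6 pluralityLoserCompleteForms = 3033600 + 1 := by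
  -- The first argument is a common multiple of the weight products at all simplicial pieces;
  -- success of the run certifies this. The 1 added on the right marks success.
  decide +kernel

set_option maxRecDepth 100000 in
theorem matrixConeVolume_pluralityLoserPartialForms :
    matrixConeVolume 246873704103936000 6 pluralityLoserPartialForms = 5231749775616000 + 1 := by
  decide +kernel

set_option maxRecDepth 100000 in
theorem matrixConeVolume_runnerUpCompleteForms :
    matrixConeVolume 20736 5 runnerUpCompleteForms = 762 + 1 := by
  decide +kernel

set_option maxRecDepth 100000 in
theorem matrixConeVolume_runnerUpPartialForms :
    matrixConeVolume 8957952 5 runnerUpPartialForms = 341496 + 1 := by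
  decide +kernel

set_option maxRecDepth 100000 in
theorem matrixConeVolume_doubleCompleteForms :
    matrixConeVolume 99532800 9 doubleCompleteForms = 669600 + 1 := by
  decide +kernel

set_option maxRecDepth 100000 in
theorem matrixConeVolume_doublePartialForms :
    matrixConeVolume 2208716216598528000 9 doublePartialForms = 14593180335552000 + 1 := by
  decide +kernel

set_option maxRecDepth 100000 in
theorem matrixConeVolume_noMajorityCompleteForms :
    matrixConeVolume 1024 3 noMajorityCompleteForms = 448 + 1 := by
  decide +kernel

set_option maxRecDepth 100000 in
theorem matrixConeVolume_noMajorityPartialForms :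
    matrixConeVolume 16384 3 noMajorityPartialForms = 9280 + 1 := by
  decide +kernel

end Volumes

/-! ### Limiting probabilities for fixed roles of the candidates -/

section Events

theorem ballot_self_notMem : ∀ A : Candidate, ballot A A ∉ completeBallots := by decide

theorem ballot_mem_complete {A B : Candidate} (h : A ≠ B) : ballot A B ∈ completeBallots := by
  revert A B
  decide

theorem ballot_mem_partial {A B : Candidate} (_ : A ≠ B) : ballot A B ∈ partialBallots :=
  Finset.mem_univ _

/-- One volume serves every labelling, as the order of the variables depends on the roles. The
margin 10 is the slack demanded by `winsBothPartsOfSplit_of_le`; its bounds `h4` and `h5` follow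
from `h1` and `h2`, since B > A ballots are among the votes of B and C > A ballots among those of C.
-/
theorem tendsto_iacProb_pluralityLoserComplete {A B C : Candidate} (hAB : A ≠ B) (hAC : A ≠ C)
    (hBC : B ≠ C) :
    Tendsto (iacProb completeBallots (fun P => IsPluralityLoser P A ∧ WinsBothPartsOfSplit P A))
        atTop (𝓝 (79 / 3456)) := by
  obtain ⟨hinj, hmem⟩ := pluralityLoserCompleteOrder_spec A B C hAB hAC hBC
  have h := tendsto_iacProb_of_cone hinj hmem (R := 6) (ls :=
      pluralityLoserCompleteForms) rfl (by decide) (by decide)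
    (by norm_num) (by decide) matrixConeVolume_pluralityLoserCompleteForms
    (E := fun P => IsPluralityLoser P A ∧ WinsBothPartsOfSplit P A)
    10 ?_ ?_
  · convert! h using 2
    norm_num
  · intro P hP h k hk
    have z1 := hP _ (ballot_self_notMem A)
    have z2 := hP _ (ballot_self_notMem B)
    have z3 := hP _ (ballot_self_notMem C)
    have s1 := firstVotes_eq hAB hAC hBC P
    have s2 := firstVotes_eq hAB.symm hBC hAC P
    have s3 := firstVotes_eq hAC.symm hBC.symm hAB P
    have h := IsPluralityLoser.inequalities hAB hAC hBC h.1 h.2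
    interval_cases k <;> simp [formCoeff, pluralityLoserCompleteForms,
        pluralityLoserCompleteOrder, Fin.sum_univ_succ] <;> omega
  · intro P hP hbig h
    have z1 := hP _ (ballot_self_notMem A)
    have z2 := hP _ (ballot_self_notMem B)
    have z3 := hP _ (ballot_self_notMem C)
    have s1 := firstVotes_eq hAB hAC hBC P
    have s2 := firstVotes_eq hAB.symm hBC hAC P
    have s3 := firstVotes_eq hAC.symm hBC.symm hAB P
    have hall : ∀ v w, ballot v w ∈ completeBallots → 10 ≤ P (ballot v w) := fun v w hvw => by
      exact_mod_cast hbig _ hvw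
    have b1 := hall A B (ballot_mem_complete hAB)
    have b2 := hall B A (ballot_mem_complete hAB.symm)
    have b3 := hall C A (ballot_mem_complete hAC.symm)
    have f0 := h 0 (by norm_num)
    have f1 := h 1 (by norm_num)
    have f2 := h 2 (by norm_num)
    have f3 := h 3 (by norm_num)
    have f4 := h 4 (by norm_num)
    have f5 := h 5 (by norm_num)
    simp [formCoeff, pluralityLoserCompleteForms, pluralityLoserCompleteOrder,
        Fin.sum_univ_succ] at f0 f1 f2 f3 f4 f5
    exact ⟨isPluralityLoser_of_lt hAB hAC hBC (by omega) (by omega),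
      winsBothPartsOfSplit_of_le hAB hAC hBC (by omega) (by omega) (by omega) (by omega) (by omega)
        (by omega) (by omega) (by omega) (by omega)⟩

theorem tendsto_iacProb_pluralityLoserPartial {A B C : Candidate} (hAB : A ≠ B) (hAC : A ≠ C) (hBC
    : B ≠ C) :
    Tendsto (iacProb partialBallots (fun P => IsPluralityLoser P A ∧ WinsBothPartsOfSplit P A))
        atTop (𝓝 (7031 / 331776)) := by
  obtain ⟨hinj, hmem⟩ := pluralityLoserPartialOrder_spec A B C hAB hAC hBC
  have h := tendsto_iacProb_of_cone hinj hmem (R := 6) (ls :=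
      pluralityLoserPartialForms) rfl (by decide) (by decide)
    (by norm_num) (by decide) matrixConeVolume_pluralityLoserPartialForms
    (E := fun P => IsPluralityLoser P A ∧ WinsBothPartsOfSplit P A)
    10 ?_ ?_
  · convert! h using 2
    norm_num
  · intro P hP h k hk
    have s1 := firstVotes_eq hAB hAC hBC P
    have s2 := firstVotes_eq hAB.symm hBC hAC P
    have s3 := firstVotes_eq hAC.symm hBC.symm hAB P
    have h := IsPluralityLoser.inequalities hAB hAC hBC h.1 h.2
    interval_cases k <;> simp [formCoeff, pluralityLoserPartialForms, pluralityLoserPartialOrder,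
        Fin.sum_univ_succ] <;> omega
  · intro P hP hbig h
    have s1 := firstVotes_eq hAB hAC hBC P
    have s2 := firstVotes_eq hAB.symm hBC hAC P
    have s3 := firstVotes_eq hAC.symm hBC.symm hAB P
    have hall : ∀ v w, ballot v w ∈ partialBallots → 10 ≤ P (ballot v w) := fun v w hvw => by
      exact_mod_cast hbig _ hvw
    have b1 := hall A B (ballot_mem_partial hAB)
    have b2 := hall B A (ballot_mem_partial hAB.symm)
    have b3 := hall C A (ballot_mem_partial hAC.symm)
    have f0 := h 0 (by norm_num)
    have f1 := h 1 (by norm_num)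
    have f2 := h 2 (by norm_num)
    have f3 := h 3 (by norm_num)
    have f4 := h 4 (by norm_num)
    have f5 := h 5 (by norm_num)
    simp [formCoeff, pluralityLoserPartialForms, pluralityLoserPartialOrder,
        Fin.sum_univ_succ] at f0 f1 f2 f3 f4 f5
    exact ⟨isPluralityLoser_of_lt hAB hAC hBC (by omega) (by omega),
      winsBothPartsOfSplit_of_le hAB hAC hBC (by omega) (by omega) (by omega) (by omega) (by omega)
        (by omega) (by omega) (by omega) (by omega)⟩

theorem tendsto_iacProb_runnerUpComplete {A B C : Candidate} (hAB : A ≠ B) (hAC : A ≠ C) (hBC : B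
    ≠ C) :
    Tendsto (iacProb completeBallots (fun P => IsIRVWinner P B ∧ IsPluralityLoser P C ∧
        WinsBothPartsOfSplit P A)) atTop (𝓝 (127 / 3456)) := by
  obtain ⟨hinj, hmem⟩ := runnerUpCompleteOrder_spec A B C hAB hAC hBC
  have h := tendsto_iacProb_of_cone hinj hmem (R := 5) (ls :=
      runnerUpCompleteForms) rfl (by decide) (by decide)
    (by norm_num) (by decide) matrixConeVolume_runnerUpCompleteForms
    (E := fun P => IsIRVWinner P B ∧ IsPluralityLoser P C ∧ WinsBothPartsOfSplit P A)
    10 ?_ ?_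
  · convert! h using 2
    norm_num
  · intro P hP h k hk
    have z1 := hP _ (ballot_self_notMem A)
    have z2 := hP _ (ballot_self_notMem B)
    have z3 := hP _ (ballot_self_notMem C)
    have s1 := firstVotes_eq hAB hAC hBC P
    have s2 := firstVotes_eq hAB.symm hBC hAC P
    have s3 := firstVotes_eq hAC.symm hBC.symm hAB P
    have h := IsIRVWinner.inequalities hAB hAC hBC h.1 h.2.1 h.2.2
    interval_cases k <;> simp [formCoeff, runnerUpCompleteForms, runnerUpCompleteOrder,
        Fin.sum_univ_succ] <;> omega
  · intro P hP hbig h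
    have z1 := hP _ (ballot_self_notMem A)
    have z2 := hP _ (ballot_self_notMem B)
    have z3 := hP _ (ballot_self_notMem C)
    have s1 := firstVotes_eq hAB hAC hBC P
    have s2 := firstVotes_eq hAB.symm hBC hAC P
    have s3 := firstVotes_eq hAC.symm hBC.symm hAB P
    have hall : ∀ v w, ballot v w ∈ completeBallots → 10 ≤ P (ballot v w) := fun v w hvw => by
      exact_mod_cast hbig _ hvw
    have b1 := hall A B (ballot_mem_complete hAB)
    have b2 := hall B A (ballot_mem_complete hAB.symm)
    have b3 := hall C A (ballot_mem_complete hAC.symm)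
    have f0 := h 0 (by norm_num)
    have f1 := h 1 (by norm_num)
    have f2 := h 2 (by norm_num)
    have f3 := h 3 (by norm_num)
    have f4 := h 4 (by norm_num)
    simp [formCoeff, runnerUpCompleteForms, runnerUpCompleteOrder,
        Fin.sum_univ_succ] at f0 f1 f2 f3 f4
    exact ⟨isIRVWinner_of_lt hBC hAB.symm hAC.symm (by omega) (by omega) (by omega),
      isPluralityLoser_of_lt hAC.symm hBC.symm hAB (by omega) (by omega),
      winsBothPartsOfSplit_of_le hAB hAC hBC (by omega) (by omega) (by omega) (by omega) (by omega)
        (by omega) (by omega) (by omega) (by omega)⟩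

theorem tendsto_iacProb_runnerUpPartial {A B C : Candidate} (hAB : A ≠ B) (hAC : A ≠ C) (hBC : B ≠
    C) :
    Tendsto (iacProb partialBallots (fun P => IsIRVWinner P B ∧ IsPluralityLoser P C ∧
        WinsBothPartsOfSplit P A)) atTop (𝓝 (527 / 13824)) := by
  obtain ⟨hinj, hmem⟩ := runnerUpPartialOrder_spec A B C hAB hAC hBC
  have h := tendsto_iacProb_of_cone hinj hmem (R := 5) (ls :=
      runnerUpPartialForms) rfl (by decide) (by decide)
    (by norm_num) (by decide) matrixConeVolume_runnerUpPartialForms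
    (E := fun P => IsIRVWinner P B ∧ IsPluralityLoser P C ∧ WinsBothPartsOfSplit P A)
    10 ?_ ?_
  · convert! h using 2
    norm_num
  · intro P hP h k hk
    have s1 := firstVotes_eq hAB hAC hBC P
    have s2 := firstVotes_eq hAB.symm hBC hAC P
    have s3 := firstVotes_eq hAC.symm hBC.symm hAB P
    have h := IsIRVWinner.inequalities hAB hAC hBC h.1 h.2.1 h.2.2
    interval_cases k <;> simp [formCoeff, runnerUpPartialForms, runnerUpPartialOrder,
        Fin.sum_univ_succ] <;> omega
  · intro P hP hbig h
    have s1 := firstVotes_eq hAB hAC hBC P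
    have s2 := firstVotes_eq hAB.symm hBC hAC P
    have s3 := firstVotes_eq hAC.symm hBC.symm hAB P
    have hall : ∀ v w, ballot v w ∈ partialBallots → 10 ≤ P (ballot v w) := fun v w hvw => by
      exact_mod_cast hbig _ hvw
    have b1 := hall A B (ballot_mem_partial hAB)
    have b2 := hall B A (ballot_mem_partial hAB.symm)
    have b3 := hall C A (ballot_mem_partial hAC.symm)
    have f0 := h 0 (by norm_num)
    have f1 := h 1 (by norm_num)
    have f2 := h 2 (by norm_num)
    have f3 := h 3 (by norm_num)
    have f4 := h 4 (by norm_num)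
    simp [formCoeff, runnerUpPartialForms, runnerUpPartialOrder,
        Fin.sum_univ_succ] at f0 f1 f2 f3 f4
    exact ⟨isIRVWinner_of_lt hBC hAB.symm hAC.symm (by omega) (by omega) (by omega),
      isPluralityLoser_of_lt hAC.symm hBC.symm hAB (by omega) (by omega),
      winsBothPartsOfSplit_of_le hAB hAC hBC (by omega) (by omega) (by omega) (by omega) (by omega)
        (by omega) (by omega) (by omega) (by omega)⟩

theorem tendsto_iacProb_doubleComplete {A B C : Candidate} (hAB : A ≠ B) (hAC : A ≠ C) (hBC : B ≠
    C) :
    Tendsto (iacProb completeBallots (fun P =>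
      (IsIRVWinner P B ∧ IsPluralityLoser P C ∧ WinsBothPartsOfSplit P A) ∧
        WinsBothPartsOfSplit P C)) atTop (𝓝 (31 / 4608)) := by
  obtain ⟨hinj, hmem⟩ := doubleCompleteOrder_spec A B C hAB hAC hBC
  have h := tendsto_iacProb_of_cone hinj hmem (R := 9) (ls :=
      doubleCompleteForms) rfl (by decide) (by decide)
    (by norm_num) (by decide) matrixConeVolume_doubleCompleteForms
    (E := fun P =>
        (IsIRVWinner P B ∧ IsPluralityLoser P C ∧ WinsBothPartsOfSplit P A) ∧
          WinsBothPartsOfSplit P C)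
    10 ?_ ?_
  · convert! h using 2
    norm_num
  · intro P hP h k hk
    have z1 := hP _ (ballot_self_notMem A)
    have z2 := hP _ (ballot_self_notMem B)
    have z3 := hP _ (ballot_self_notMem C)
    have s1 := firstVotes_eq hAB hAC hBC P
    have s2 := firstVotes_eq hAB.symm hBC hAC P
    have s3 := firstVotes_eq hAC.symm hBC.symm hAB P
    have h1 := IsIRVWinner.inequalities hAB hAC hBC h.1.1 h.1.2.1 h.1.2.2
    have h2 := IsPluralityLoser.inequalities hAC.symm hBC.symm hAB h.1.2.1 h.2
    interval_cases k <;> simp [formCoeff, doubleCompleteForms, doubleCompleteOrder,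
        Fin.sum_univ_succ] <;> omega
  · intro P hP hbig h
    have z1 := hP _ (ballot_self_notMem A)
    have z2 := hP _ (ballot_self_notMem B)
    have z3 := hP _ (ballot_self_notMem C)
    have s1 := firstVotes_eq hAB hAC hBC P
    have s2 := firstVotes_eq hAB.symm hBC hAC P
    have s3 := firstVotes_eq hAC.symm hBC.symm hAB P
    have hall : ∀ v w, ballot v w ∈ completeBallots → 10 ≤ P (ballot v w) := fun v w hvw => by
      exact_mod_cast hbig _ hvw
    have b1 := hall A B (ballot_mem_complete hAB)
    have b2 := hall B A (ballot_mem_complete hAB.symm)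
    have b3 := hall C A (ballot_mem_complete hAC.symm)
    have f0 := h 0 (by norm_num)
    have f1 := h 1 (by norm_num)
    have f2 := h 2 (by norm_num)
    have f3 := h 3 (by norm_num)
    have f4 := h 4 (by norm_num)
    have f5 := h 5 (by norm_num)
    have f6 := h 6 (by norm_num)
    have f7 := h 7 (by norm_num)
    have f8 := h 8 (by norm_num)
    simp [formCoeff, doubleCompleteForms, doubleCompleteOrder,
        Fin.sum_univ_succ] at f0 f1 f2 f3 f4 f5 f6 f7 f8
    exact ⟨⟨isIRVWinner_of_lt hBC hAB.symm hAC.symm (by omega) (by omega) (by omega),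
      isPluralityLoser_of_lt hAC.symm hBC.symm hAB (by omega) (by omega),
      winsBothPartsOfSplit_of_le hAB hAC hBC (by omega) (by omega) (by omega) (by omega) (by omega)
        (by omega) (by omega) (by omega) (by omega)⟩,
      winsBothPartsOfSplit_of_le hAC.symm hBC.symm hAB (by omega) (by omega) (by omega) (by omega)
        (by omega) (by omega) (by omega) (by omega) (by omega)⟩

theorem tendsto_iacProb_doublePartial {A B C : Candidate} (hAB : A ≠ B) (hAC : A ≠ C) (hBC : B ≠
    C) :
    Tendsto (iacProb partialBallots (fun P =>
      (IsIRVWinner P B ∧ IsPluralityLoser P C ∧ WinsBothPartsOfSplit P A) ∧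
        WinsBothPartsOfSplit P C)) atTop (𝓝 (210439 / 31850496)) := by
  obtain ⟨hinj, hmem⟩ := doublePartialOrder_spec A B C hAB hAC hBC
  have h := tendsto_iacProb_of_cone hinj hmem (R := 9) (ls :=
      doublePartialForms) rfl (by decide) (by decide)
    (by norm_num) (by decide) matrixConeVolume_doublePartialForms
    (E := fun P =>
        (IsIRVWinner P B ∧ IsPluralityLoser P C ∧ WinsBothPartsOfSplit P A) ∧
          WinsBothPartsOfSplit P C)
    10 ?_ ?_
  · convert! h using 2
    norm_num
  · intro P hP h k hk
    have s1 := firstVotes_eq hAB hAC hBC P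
    have s2 := firstVotes_eq hAB.symm hBC hAC P
    have s3 := firstVotes_eq hAC.symm hBC.symm hAB P
    have h1 := IsIRVWinner.inequalities hAB hAC hBC h.1.1 h.1.2.1 h.1.2.2
    have h2 := IsPluralityLoser.inequalities hAC.symm hBC.symm hAB h.1.2.1 h.2
    interval_cases k <;> simp [formCoeff, doublePartialForms, doublePartialOrder,
        Fin.sum_univ_succ] <;> omega
  · intro P hP hbig h
    have s1 := firstVotes_eq hAB hAC hBC P
    have s2 := firstVotes_eq hAB.symm hBC hAC P
    have s3 := firstVotes_eq hAC.symm hBC.symm hAB P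
    have hall : ∀ v w, ballot v w ∈ partialBallots → 10 ≤ P (ballot v w) := fun v w hvw => by
      exact_mod_cast hbig _ hvw
    have b1 := hall A B (ballot_mem_partial hAB)
    have b2 := hall B A (ballot_mem_partial hAB.symm)
    have b3 := hall C A (ballot_mem_partial hAC.symm)
    have f0 := h 0 (by norm_num)
    have f1 := h 1 (by norm_num)
    have f2 := h 2 (by norm_num)
    have f3 := h 3 (by norm_num)
    have f4 := h 4 (by norm_num)
    have f5 := h 5 (by norm_num)
    have f6 := h 6 (by norm_num)
    have f7 := h 7 (by norm_num)
    have f8 := h 8 (by norm_num)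
    simp [formCoeff, doublePartialForms, doublePartialOrder,
        Fin.sum_univ_succ] at f0 f1 f2 f3 f4 f5 f6 f7 f8
    exact ⟨⟨isIRVWinner_of_lt hBC hAB.symm hAC.symm (by omega) (by omega) (by omega),
      isPluralityLoser_of_lt hAC.symm hBC.symm hAB (by omega) (by omega),
      winsBothPartsOfSplit_of_le hAB hAC hBC (by omega) (by omega) (by omega) (by omega) (by omega)
        (by omega) (by omega) (by omega) (by omega)⟩,
      winsBothPartsOfSplit_of_le hAC.symm hBC.symm hAB (by omega) (by omega) (by omega) (by omega)
        (by omega) (by omega) (by omega) (by omega) (by omega)⟩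

theorem tendsto_iacProb_noMajorityComplete {A B C : Candidate} (hAB : A ≠ B) (hAC : A ≠ C) (hBC :
    B ≠ C) :
    Tendsto (iacProb completeBallots NoMajorityCandidate) atTop (𝓝 (7 / 16)) := by
  obtain ⟨hinj, hmem⟩ := noMajorityCompleteOrder_spec A B C hAB hAC hBC
  have h := tendsto_iacProb_of_cone hinj hmem (R := 3) (ls :=
      noMajorityCompleteForms) rfl (by decide) (by decide)
    (by norm_num) (by decide) matrixConeVolume_noMajorityCompleteForms
    (E := NoMajorityCandidate)
    10 ?_ ?_
  · convert! h using 2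
    norm_num
  · intro P hP h k hk
    have z1 := hP _ (ballot_self_notMem A)
    have z2 := hP _ (ballot_self_notMem B)
    have z3 := hP _ (ballot_self_notMem C)
    have s1 := firstVotes_eq hAB hAC hBC P
    have s2 := firstVotes_eq hAB.symm hBC hAC P
    have s3 := firstVotes_eq hAC.symm hBC.symm hAB P
    have h := (noMajorityCandidate_iff hAB hAC hBC).1 h
    interval_cases k <;> simp [formCoeff, noMajorityCompleteForms, noMajorityCompleteOrder,
        Fin.sum_univ_succ] <;> omega
  · intro P hP hbig h
    have z1 := hP _ (ballot_self_notMem A)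
    have z2 := hP _ (ballot_self_notMem B)
    have z3 := hP _ (ballot_self_notMem C)
    have s1 := firstVotes_eq hAB hAC hBC P
    have s2 := firstVotes_eq hAB.symm hBC hAC P
    have s3 := firstVotes_eq hAC.symm hBC.symm hAB P
    have f0 := h 0 (by norm_num)
    have f1 := h 1 (by norm_num)
    have f2 := h 2 (by norm_num)
    simp [formCoeff, noMajorityCompleteForms, noMajorityCompleteOrder,
        Fin.sum_univ_succ] at f0 f1 f2
    exact (noMajorityCandidate_iff hAB hAC hBC).2 ⟨by omega, by omega, by omega⟩

theorem tendsto_iacProb_noMajorityPartial {A B C : Candidate} (hAB : A ≠ B) (hAC : A ≠ C) (hBC : B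
    ≠ C) :
    Tendsto (iacProb partialBallots NoMajorityCandidate) atTop (𝓝 (145 / 256)) := by
  obtain ⟨hinj, hmem⟩ := noMajorityPartialOrder_spec A B C hAB hAC hBC
  have h := tendsto_iacProb_of_cone hinj hmem (R := 3) (ls :=
      noMajorityPartialForms) rfl (by decide) (by decide)
    (by norm_num) (by decide) matrixConeVolume_noMajorityPartialForms
    (E := NoMajorityCandidate)
    10 ?_ ?_
  · convert! h using 2
    norm_num
  · intro P hP h k hk
    have s1 := firstVotes_eq hAB hAC hBC P
    have s2 := firstVotes_eq hAB.symm hBC hAC P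
    have s3 := firstVotes_eq hAC.symm hBC.symm hAB P
    have h := (noMajorityCandidate_iff hAB hAC hBC).1 h
    interval_cases k <;> simp [formCoeff, noMajorityPartialForms, noMajorityPartialOrder,
        Fin.sum_univ_succ] <;> omega
  · intro P hP hbig h
    have s1 := firstVotes_eq hAB hAC hBC P
    have s2 := firstVotes_eq hAB.symm hBC hAC P
    have s3 := firstVotes_eq hAC.symm hBC.symm hAB P
    have f0 := h 0 (by norm_num)
    have f1 := h 1 (by norm_num)
    have f2 := h 2 (by norm_num)
    simp [formCoeff, noMajorityPartialForms, noMajorityPartialOrder, Fin.sum_univ_succ] at f0 f1 f2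
    exact (noMajorityCandidate_iff hAB hAC hBC).2 ⟨by omega, by omega, by omega⟩

end Events

/-! ### Summation over roles, and conditioning -/

section Paradoxes

theorem exists_distinct (A : Candidate) : ∃ B C, A ≠ B ∧ A ≠ C ∧ B ≠ C := by
  revert A
  decide

theorem tendsto_iacProb_PLParadox {S : Finset Ballot} {p : ℝ}
    (h : ∀ A B C : Candidate, A ≠ B → A ≠ C → B ≠ C → Tendsto
      (iacProb S fun P => IsPluralityLoser P A ∧ WinsBothPartsOfSplit P A) atTop (𝓝 p)) :
    Tendsto (iacProb S PLParadox) atTop (𝓝 (3 * p)) := by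
  have hsum := tendsto_finsetSum Finset.univ fun (A : Candidate) _ => by
    obtain ⟨B, C, hAB, hAC, hBC⟩ := exists_distinct A
    exact h A B C hAB hAC hBC
  rw [Finset.sum_const, Finset.card_univ, Fintype.card_fin, nsmul_eq_mul] at hsum
  refine hsum.congr fun V => ?_
  exact (iacProb_exists (F := fun A P => IsPluralityLoser P A ∧ WinsBothPartsOfSplit P A)
    (fun _ _ _ hA hB => hA.1.unique hB.1) V).symm

/-- The winner and the plurality loser are unique, so the six assignments of roles give disjoint
events of equal limiting probability. -/
theorem tendsto_iacProb_RUParadox {S : Finset Ballot} {p : ℝ}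
    (h : ∀ A B C : Candidate, A ≠ B → A ≠ C → B ≠ C → Tendsto (iacProb S fun P =>
      IsIRVWinner P B ∧ IsPluralityLoser P C ∧ WinsBothPartsOfSplit P A) atTop (𝓝 p)) :
    Tendsto (iacProb S RUParadox) atTop (𝓝 (6 * p)) := by
  have hsum := tendsto_finsetSum Finset.univ fun (σ : Equiv.Perm Candidate) _ =>
    h (σ 0) (σ 1) (σ 2) (by simp) (by simp) (by simp)
  rw [Finset.sum_const, Finset.card_univ, Fintype.card_perm, Fintype.card_fin, nsmul_eq_mul] at hsum
  rw [iacProb_congr RUParadox_iff]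
  refine hsum.congr fun V => ?_
  exact (iacProb_exists (F := RUParadoxFor) (fun _ _ _ hσ hτ => hσ.unique hτ) V).symm

theorem tendsto_iacProb_DoubleParadox {S : Finset Ballot} {p : ℝ}
    (h : ∀ A B C : Candidate, A ≠ B → A ≠ C → B ≠ C → Tendsto (iacProb S fun P =>
      (IsIRVWinner P B ∧ IsPluralityLoser P C ∧ WinsBothPartsOfSplit P A) ∧
        WinsBothPartsOfSplit P C) atTop (𝓝 p)) :
    Tendsto (iacProb S DoubleParadox) atTop (𝓝 (6 * p)) := by
  have hsum := tendsto_finsetSum Finset.univ fun (σ : Equiv.Perm Candidate) _ =>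
    h (σ 0) (σ 1) (σ 2) (by simp) (by simp) (by simp)
  rw [Finset.sum_const, Finset.card_univ, Fintype.card_perm, Fintype.card_fin, nsmul_eq_mul] at hsum
  rw [iacProb_congr DoubleParadox_iff]
  refine hsum.congr fun V => ?_
  exact (iacProb_exists (F := fun σ P => RUParadoxFor σ P ∧ WinsBothPartsOfSplit P (σ 2))
    (fun _ _ _ hσ hτ => hσ.1.unique hτ.1) V).symm

theorem tendsto_iacProb_EitherParadox {S : Finset Ballot} {p q r : ℝ}
    (hp : Tendsto (iacProb S PLParadox) atTop (𝓝 p))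
    (hq : Tendsto (iacProb S RUParadox) atTop (𝓝 q))
    (hr : Tendsto (iacProb S DoubleParadox) atTop (𝓝 r)) :
    Tendsto (iacProb S EitherParadox) atTop (𝓝 (p + q - r)) :=
  ((hp.add hq).sub hr).congr fun V => (iacProb_or S PLParadox RUParadox V).symm

/-- If `E` implies `F`, the conditional probability is a plain quotient. -/
theorem tendsto_iacCondProb {S : Finset Ballot} {E F : Profile → Prop} {p q : ℝ}
    (hE : Tendsto (iacProb S E) atTop (𝓝 p)) (hF : Tendsto (iacProb S F) atTop (𝓝 q))
    (hq : q ≠ 0) (hEF : ∀ P, E P → F P) : Tendsto (iacCondProb S E F) atTop (𝓝 (p / q)) := by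
  refine (hE.div hF hq).congr fun V => ?_
  rw [Pi.div_apply, iacCondProb, iacProb_congr fun P => ⟨fun h => ⟨h, hEF P h⟩, And.left⟩]

theorem tendsto_iacProb_and_iacCondProb {S : Finset Ballot} {p q r s : ℝ} (hs : s ≠ 0)
    (hPL : ∀ A B C : Candidate, A ≠ B → A ≠ C → B ≠ C → Tendsto
      (iacProb S fun P => IsPluralityLoser P A ∧ WinsBothPartsOfSplit P A) atTop (𝓝 p))
    (hRU : ∀ A B C : Candidate, A ≠ B → A ≠ C → B ≠ C → Tendsto (iacProb S fun P =>
      IsIRVWinner P B ∧ IsPluralityLoser P C ∧ WinsBothPartsOfSplit P A) atTop (𝓝 q))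
    (hD : ∀ A B C : Candidate, A ≠ B → A ≠ C → B ≠ C → Tendsto (iacProb S fun P =>
      (IsIRVWinner P B ∧ IsPluralityLoser P C ∧ WinsBothPartsOfSplit P A) ∧
        WinsBothPartsOfSplit P C) atTop (𝓝 r))
    (hNM : Tendsto (iacProb S NoMajorityCandidate) atTop (𝓝 s)) :
    (Tendsto (iacProb S EitherParadox) atTop (𝓝 (3 * p + 6 * q - 6 * r)) ∧
      Tendsto (iacProb S RUParadox) atTop (𝓝 (6 * q)) ∧
      Tendsto (iacProb S PLParadox) atTop (𝓝 (3 * p)) ∧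
      Tendsto (iacProb S DoubleParadox) atTop (𝓝 (6 * r))) ∧
    (Tendsto (iacCondProb S EitherParadox NoMajorityCandidate) atTop
        (𝓝 ((3 * p + 6 * q - 6 * r) / s)) ∧
      Tendsto (iacCondProb S RUParadox NoMajorityCandidate) atTop (𝓝 (6 * q / s)) ∧
      Tendsto (iacCondProb S PLParadox NoMajorityCandidate) atTop (𝓝 (3 * p / s)) ∧
      Tendsto (iacCondProb S DoubleParadox NoMajorityCandidate) atTop (𝓝 (6 * r / s))) := by
  have h1 := tendsto_iacProb_PLParadox hPL
  have h2 := tendsto_iacProb_RUParadox hRU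
  have h3 := tendsto_iacProb_DoubleParadox hD
  have h4 := tendsto_iacProb_EitherParadox h1 h2 h3
  exact ⟨⟨h4, h2, h1, h3⟩, tendsto_iacCondProb h4 hNM hs fun _ h => h.noMajorityCandidate,
    tendsto_iacCondProb h2 hNM hs fun _ h => EitherParadox.noMajorityCandidate (Or.inr h),
    tendsto_iacCondProb h1 hNM hs fun _ h => EitherParadox.noMajorityCandidate (Or.inl h),
    tendsto_iacCondProb h3 hNM hs fun _ h => EitherParadox.noMajorityCandidate (Or.inl h.1)⟩

end Paradoxes

theorem proposition5 :
    -- complete ballots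
    (Tendsto (iacProb completeBallots EitherParadox) atTop (𝓝 (191 / 768)) ∧
      Tendsto (iacProb completeBallots RUParadox) atTop (𝓝 (127 / 576)) ∧
      Tendsto (iacProb completeBallots PLParadox) atTop (𝓝 (79 / 1152)) ∧
      Tendsto (iacProb completeBallots DoubleParadox) atTop (𝓝 (31 / 768))) ∧
    -- complete ballots, given that there is no majority candidate
    (Tendsto (iacCondProb completeBallots EitherParadox NoMajorityCandidate) atTop
        (𝓝 (191 / 336)) ∧
      Tendsto (iacCondProb completeBallots RUParadox NoMajorityCandidate) atTop
        (𝓝 (127 / 252)) ∧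
      Tendsto (iacCondProb completeBallots PLParadox NoMajorityCandidate) atTop
        (𝓝 (79 / 504)) ∧
      Tendsto (iacCondProb completeBallots DoubleParadox NoMajorityCandidate) atTop
        (𝓝 (31 / 336))) ∧
    -- partial ballots
    (Tendsto (iacProb partialBallots EitherParadox) atTop (𝓝 (1341257 / 5308416)) ∧
      Tendsto (iacProb partialBallots RUParadox) atTop (𝓝 (527 / 2304)) ∧
      Tendsto (iacProb partialBallots PLParadox) atTop (𝓝 (7031 / 110592)) ∧
      Tendsto (iacProb partialBallots DoubleParadox) atTop (𝓝 (210439 / 5308416))) ∧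
    -- partial ballots, given that there is no majority candidate
    (Tendsto (iacCondProb partialBallots EitherParadox NoMajorityCandidate) atTop
        (𝓝 (1341257 / 3006720)) ∧
      Tendsto (iacCondProb partialBallots RUParadox NoMajorityCandidate) atTop
        (𝓝 (527 / 1305)) ∧
      Tendsto (iacCondProb partialBallots PLParadox NoMajorityCandidate) atTop
        (𝓝 (7031 / 62640)) ∧
      Tendsto (iacCondProb partialBallots DoubleParadox NoMajorityCandidate) atTop
        (𝓝 (210439 / 3006720))) := by

  have h01 : (0 : Candidate) ≠ 1 := by decide
  have h02 : (0 : Candidate) ≠ 2 := by decide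
  have h12 : (1 : Candidate) ≠ 2 := by decide
  have hc := tendsto_iacProb_and_iacCondProb (by norm_num)
    (fun _ _ _ => tendsto_iacProb_pluralityLoserComplete)
    (fun _ _ _ => tendsto_iacProb_runnerUpComplete) (fun _ _ _ => tendsto_iacProb_doubleComplete)
    (tendsto_iacProb_noMajorityComplete h01 h02 h12)
  have hp := tendsto_iacProb_and_iacCondProb (by norm_num)
    (fun _ _ _ => tendsto_iacProb_pluralityLoserPartial)
    (fun _ _ _ => tendsto_iacProb_runnerUpPartial) (fun _ _ _ => tendsto_iacProb_doublePartial)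
    (tendsto_iacProb_noMajorityPartial h01 h02 h12)
  norm_num at hc hp
  exact ⟨hc.1, hc.2, hp.1, hp.2⟩
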